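/- Let $SE(2)=\mathbb{R}^2\rtimes SO(2)$, with elements $g=(\mathbf{x},\mathbf{R}_\theta)$ and group law $(\mathbf{x},\mathbf{R})(\mathbf{x}',\mathbf{R}')=(\mathbf{x}+\mathbf{R}\mathbf{x}',\mathbf{R}\mathbf{R}')$. Fix a constant $c>0$ and the Haar measure $dg=c\,dx_1\,dx_2\,d\theta$ on $SE(2)$, where $d\theta$ has total mass $2\pi$. Let $\Gamma=\mathbb{Z}^2$ be the subgroup of integral translations. For a function $F$ on $SE(2)$ put $\widetilde F(\Gamma g)=\sum_{\gamma\in\Gamma}F(\gamma g)$, and let $\mu$ be the invariant measure on the right coset space $\Gamma\backslash SE(2)$ normalized by Weil's formula $\int_{\Gamma\backslash SE(2)}\widetilde F\,d\mu=\int_{SE(2)}F(g)\,dg$. For $p>0$ let $U_p$ be the representation of $SE(2)$ on $L^2(\mathbb{S}^1)$ given by $[U_p(g)\varphi](\mathbf{u})=e^{-ip\langle\mathbf{u},\mathbf{x}\rangle}\varphi(\mathbf{R}_\theta^{T}\mathbf{u})$ for $g=(\mathbf{x},\mathbf{R}_\theta)$, where the inner product of $L^2(\mathbb{S}^1)$ is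 $\langle u,v\rangle=\frac1{2\pi}\int_0^{2\pi}u(\alpha)\overline{v(\alpha)}\,d\alpha$, and let $\mathbf{e}_k(\cos\alpha,\sin\alpha)=e^{ik\alpha}$. For $f\in L^1(SE(2))$ put $$\widehat f(p)=\int_{SE(2)}f(g)\,U_p(g^{-1})\,dg,\qquad \widehat f(p)_{nm}=\langle\widehat f(p)\mathbf{e}_n,\mathbf{e}_m\rangle,\qquad \widehat f[k]=\int_{SE(2)}f(\mathbf{x},\mathbf{R}_\theta)\,e^{-ik\theta}\,dg .$$ Let $\mathcal{R}=\{\sqrt{k_1^2+k_2^2}:(k_1,k_2)\in\mathbb{Z}^2\setminus\{(0,0)\}\}$ and, for $\rho\in\mathcal{R}$, let $\Theta_\rho$ be the set of the $\theta\in[0,2\pi)$ with $(\rho\cos\theta,\rho\sin\theta)\in\mathbb{Z}^2$. **Theorem.** Let $f\in L^1(SE(2))$ with $\widetilde{|f|}\in L^2(\Gamma\backslash SE(2),\mu)$. Then $\widetilde f\in L^2(\Gamma\backslash SE(2),\mu)$; for all $\rho\in\mathcal{R}$, $\theta\in\Theta_\rho$, $m\in\mathbb{Z}$ the series $\sum_{n\in\mathbb{Z}}e^{-in\theta}\widehat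 f(2\pi\rho)_{nm}$ converges, in the sense that $\lim_{M,N\to\infty}\sum_{n=-M}^{N}$ exists; and $$2\pi c\,\|\widetilde f\|_{L^2(\Gamma\backslash SE(2),\mu)}^2=\sum_{k\in\mathbb{Z}}\bigl|\widehat f[k]\bigr|^2+\sum_{\rho\in\mathcal{R}}\sum_{\theta\in\Theta_\rho}\sum_{m\in\mathbb{Z}}\Bigl|\sum_{n\in\mathbb{Z}}e^{-in\theta}\,\widehat f(2\pi\rho)_{nm}\Bigr|^2 .$$ In particular, the factor $2\pi c$ is $1$ for $dg=\frac1{2\pi}dx_1dx_2d\theta$ (the normalization for which $\mu$ is a probability measure), and it is $\frac1{2\pi}$ for $dg=\frac1{4\pi^2}dx_1dx_2d\theta$. -/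

import Mathlib

open MeasureTheory
open scoped ENNReal

noncomputable section

namespace SE2Plancherel

instance instFactTwoPiPos : Fact (0 < 2 * Real.pi) := ⟨Real.two_pi_pos⟩

/-- The circle of angles `ℝ / 2πℤ`. It parametrizes both the rotations `R_θ` and the points
`u_α = (cos α, sin α)` of the unit circle `𝕊¹`. -/
abbrev Angle : Type := AddCircle (2 * Real.pi)

/-- The unit vector `u_α = (cos α, sin α)`, with the plane `ℝ²` identified with `ℂ`. -/
def unitVec (α : Angle) : ℂ := fourier 1 α

theorem unitVec_coe (α : ℝ) : unitVec (α : Angle) = Complex.exp (Complex.I * α) := by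
  have h : (Real.pi : ℂ) ≠ 0 := by exact_mod_cast Real.pi_ne_zero
  simp only [unitVec, fourier_coe_apply]
  congr 1
  push_cast
  field_simp

theorem unitVec_zero : unitVec 0 = 1 := by simp [unitVec]

theorem unitVec_add (α β : Angle) : unitVec (α + β) = unitVec α * unitVec β := by
  simp [unitVec, AddCircle.toCircle_add]

theorem continuous_unitVec : Continuous unitVec := (fourier 1).continuous

/-! ### The group SE(2) -/

/-- Elements `(x, R_θ)` of the special Euclidean group of the plane. The plane is identified with
`ℂ`, so that the rotation `R_θ` is multiplication by `u_θ = e^{iθ}`. -/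
@[ext]
structure SE2 where
  /-- the translation part `x` -/
  trans : ℂ
  /-- the angle `θ` of the rotation part `R_θ` -/
  rot : Angle

namespace SE2

instance : Mul SE2 := ⟨fun g h => ⟨g.trans + unitVec g.rot * h.trans, g.rot + h.rot⟩⟩

instance : One SE2 := ⟨⟨0, 0⟩⟩

instance : Inv SE2 := ⟨fun g => ⟨-(unitVec (-g.rot) * g.trans), -g.rot⟩⟩

@[simp] theorem mul_trans (g h : SE2) : (g * h).trans = g.trans + unitVec g.rot * h.trans := rfl

@[simp] theorem mul_rot (g h : SE2) : (g * h).rot = g.rot + h.rot := rfl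

@[simp] theorem one_trans : (1 : SE2).trans = 0 := rfl

@[simp] theorem one_rot : (1 : SE2).rot = 0 := rfl

@[simp] theorem inv_trans (g : SE2) : (g⁻¹).trans = -(unitVec (-g.rot) * g.trans) := rfl

@[simp] theorem inv_rot (g : SE2) : (g⁻¹).rot = -g.rot := rfl

instance : Group SE2 :=
  Group.ofLeftAxioms
    (fun a b c => by
      ext
      · simp only [mul_trans, mul_rot, unitVec_add]
        ring
      · simp only [mul_rot, add_assoc])
    (fun a => by ext <;> simp [unitVec_zero])
    (fun a => by ext <;> simp)

/-- The parametrization `(x, θ) ↦ (x, R_θ)`. -/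
def equivProd : SE2 ≃ ℂ × Angle where
  toFun g := (g.trans, g.rot)
  invFun p := ⟨p.1, p.2⟩
  left_inv _ := rfl
  right_inv _ := rfl

instance : TopologicalSpace SE2 := TopologicalSpace.induced equivProd inferInstance

instance : MeasurableSpace SE2 := MeasurableSpace.comap equivProd inferInstance

/-- The parametrization as an isomorphism of measurable spaces. -/
def measEquivProd : SE2 ≃ᵐ ℂ × Angle where
  toEquiv := equivProd
  measurable_toFun := comap_measurable _
  measurable_invFun := by
    rintro s ⟨t, ht, rfl⟩
    exact ht

theorem measurable_trans : Measurable SE2.trans := measurable_fst.comp measEquivProd.measurable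

theorem measurable_rot : Measurable SE2.rot := measurable_snd.comp measEquivProd.measurable

end SE2

/-- The Haar measure `dg = c dx₁ dx₂ dθ` on SE(2), with the normalizing constant `c`. -/
def haar (c : ℝ) : Measure SE2 :=
  ENNReal.ofReal c •
    Measure.map SE2.measEquivProd.symm ((volume : Measure ℂ).prod (volume : Measure Angle))

/-! ### The coset space ℤ² \ SE(2) -/

/-- The lattice `ℤ²` of integral translations, as a subgroup of SE(2). -/
def lattice : Subgroup SE2 where
  carrier := {g | (∃ k l : ℤ, g.trans = k + l * Complex.I) ∧ g.rot = 0}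
  mul_mem' := by
    rintro a b ⟨⟨k, l, h⟩, ha⟩ ⟨⟨k', l', h'⟩, hb⟩
    refine ⟨⟨k + k', l + l', ?_⟩, by simp [ha, hb]⟩
    simp only [SE2.mul_trans, h, h', ha, unitVec_zero]
    push_cast
    ring
  one_mem' := ⟨⟨0, 0, by simp⟩, rfl⟩
  inv_mem' := by
    rintro a ⟨⟨k, l, h⟩, ha⟩
    refine ⟨⟨-k, -l, ?_⟩, by simp [ha]⟩
    simp only [SE2.inv_trans, h, ha, neg_zero, unitVec_zero]
    push_cast
    ring

/-- The space `Γ \ SE(2)` of right cosets `Γ g`, for `Γ = ℤ²`. -/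
abbrev CosetSpace : Type := Quotient (QuotientGroup.rightRel lattice)

/-- The canonical map `g ↦ Γ g`. -/
def toCoset (g : SE2) : CosetSpace := Quotient.mk _ g

/-- The periodization `F̃(Γ g) = ∑_{γ ∈ Γ} F(γ g)`. -/
def periodize {E : Type*} [AddCommMonoid E] [TopologicalSpace E] (F : SE2 → E) : CosetSpace → E :=
  Quotient.lift (fun g => ∑' γ : lattice, F (γ * g)) (by
    rintro _ b ⟨γ₀, rfl⟩
    refine Eq.trans ?_ ((Equiv.mulRight γ₀).tsum_eq (fun γ : lattice => F (γ * b)))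
    refine tsum_congr fun γ => ?_
    simp [Subgroup.smul_def, mul_assoc])

/-- The fundamental domain of `ℤ²` given by `(x₁, x₂) ∈ [0,1)²` and arbitrary angle. -/
def fundDomain : Set SE2 := {g | g.trans.re ∈ Set.Ico (0 : ℝ) 1 ∧ g.trans.im ∈ Set.Ico (0 : ℝ) 1}

/-- The invariant measure `μ` on `Γ \ SE(2)` that is normalized by Weil's formula relative to
`dg = c dx₁ dx₂ dθ` (see `weil_formula`): the image of the restriction of `dg` to a
fundamental domain. -/
def cosetMeasure (c : ℝ) : Measure CosetSpace :=
  Measure.map toCoset ((haar c).restrict fundDomain)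

theorem measurable_toCoset : Measurable toCoset := fun _ hs => hs

theorem measurePreserving_lattice_mul (c : ℝ) (γ : lattice) :
    MeasurePreserving (fun g : SE2 => γ • g) (haar c) (haar c) := by
  have h1 : MeasurePreserving (fun p : ℂ × Angle => ((γ : SE2).trans + p.1, p.2))
      ((volume : Measure ℂ).prod (volume : Measure Angle))
      ((volume : Measure ℂ).prod (volume : Measure Angle)) :=
    (measurePreserving_add_left volume _).prod (MeasurePreserving.id _)
  have h2 : MeasurePreserving SE2.measEquivProd.symm
      ((volume : Measure ℂ).prod (volume : Measure Angle))
      (Measure.map SE2.measEquivProd.symm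
        ((volume : Measure ℂ).prod (volume : Measure Angle))) :=
    SE2.measEquivProd.symm.measurable.measurePreserving _
  have h3 := ((h2.comp h1).comp (h2.symm SE2.measEquivProd.symm)).smul_measure (ENNReal.ofReal c)
  convert! h3 using 1
  funext g
  have hγ : (γ : SE2).rot = 0 := γ.2.2
  change (γ : SE2) * g = ⟨(γ : SE2).trans + g.trans, g.rot⟩
  ext <;> simp [hγ, unitVec_zero]

theorem countable_lattice : Countable lattice := by
  have : Set.Countable ((fun p : ℤ × ℤ => (⟨p.1 + p.2 * Complex.I, 0⟩ : SE2)) '' Set.univ) :=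
    Set.countable_univ.image _
  refine (this.mono ?_).to_subtype
  rintro g ⟨⟨k, l, h⟩, h0⟩
  exact ⟨(k, l), trivial, by ext <;> simp [h, h0]⟩

theorem isFundamentalDomain_fundDomain (c : ℝ) :
    IsFundamentalDomain lattice fundDomain (haar c) := by
  refine IsFundamentalDomain.mk' ?_ ?_
  · refine MeasurableSet.nullMeasurableSet ?_
    exact ((Complex.measurable_re.comp SE2.measurable_trans) measurableSet_Ico).inter
      ((Complex.measurable_im.comp SE2.measurable_trans) measurableSet_Ico)
  · intro g
    refine ⟨⟨⟨(-⌊g.trans.re⌋ : ℤ) + (-⌊g.trans.im⌋ : ℤ) * Complex.I, 0⟩, ⟨_, _, rfl⟩, rfl⟩, ?_, ?_⟩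
    · simp only [Subgroup.smul_def, fundDomain, smul_eq_mul]
      simp only [Set.mem_ofPred_eq, SE2.mul_trans, unitVec_zero, one_mul]
      simp only [Complex.add_re, Complex.add_im, Complex.mul_re, Complex.mul_im, Complex.I_re,
        Complex.I_im, Complex.intCast_re, Complex.intCast_im, Set.mem_Ico]
      push_cast
      have a1 := Int.floor_le g.trans.re
      have a2 := Int.lt_floor_add_one g.trans.re
      have a3 := Int.floor_le g.trans.im
      have a4 := Int.lt_floor_add_one g.trans.im
      refine ⟨⟨?_, ?_⟩, ?_, ?_⟩ <;> linarith
    · rintro ⟨γ, ⟨k, l, h⟩, h0⟩ hγ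
      simp only [Subgroup.smul_def, fundDomain, smul_eq_mul] at hγ
      simp only [Set.mem_ofPred_eq, SE2.mul_trans, h, h0, unitVec_zero, one_mul] at hγ
      simp only [Complex.add_re, Complex.add_im, Complex.mul_re, Complex.mul_im, Complex.I_re,
        Complex.I_im, Complex.intCast_re, Complex.intCast_im, Set.mem_Ico] at hγ
      obtain ⟨⟨b1, b2⟩, b3, b4⟩ := hγ
      have e1 : ⌊g.trans.re⌋ = -k := by
        rw [Int.floor_eq_iff]; push_cast; constructor <;> linarith
      have e2 : ⌊g.trans.im⌋ = -l := by
        rw [Int.floor_eq_iff]; push_cast; constructor <;> linarith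
      apply Subtype.ext
      ext <;> simp [h, h0, e1, e2]

/-- Weil's formula, which determines `μ`. -/
theorem weil_formula (c : ℝ) (F : SE2 → ℝ≥0∞) (hF : Measurable F) :
    ∫⁻ q, periodize F q ∂(cosetMeasure c) = ∫⁻ g, F g ∂(haar c) := by
  have := countable_lattice
  have hm : ∀ γ : lattice, Measurable fun g : SE2 => F (γ * g) := fun γ =>
    hF.comp (measurePreserving_lattice_mul c γ).measurable
  have hsum : Measurable fun g : SE2 => ∑' γ : lattice, F (γ * g) :=
    Measurable.tsum hm
  have hp : Measurable (periodize F) := fun s hs => hsum hs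
  have : SMulInvariantMeasure lattice SE2 (haar c) :=
    ⟨fun γ _ hs => (measurePreserving_lattice_mul c γ).measure_preimage hs.nullMeasurableSet⟩
  have : MeasurableConstSMul lattice SE2 :=
    ⟨fun γ => (measurePreserving_lattice_mul c γ).measurable⟩
  rw [cosetMeasure, lintegral_map hp measurable_toCoset,
    (isFundamentalDomain_fundDomain c).lintegral_eq_tsum'' F]
  change ∫⁻ g in fundDomain, ∑' γ : lattice, F (γ * g) ∂(haar c) = _
  rw [lintegral_tsum fun γ => (hm γ).aemeasurable]
  rfl

/-! ### The Fourier transform on SE(2) -/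

/-- The Hilbert space `L²(𝕊¹)`, for the inner product `(1/2π) ∫₀^{2π} u(α) conj v(α) dα`. -/
abbrev L2Circle : Type := Lp ℂ 2 (AddCircle.haarAddCircle (T := 2 * Real.pi))

/-- The standard orthonormal basis `e_k(u_α) = e^{ikα}` of `L²(𝕊¹)`. -/
def basisFun (k : ℤ) : L2Circle := fourierLp 2 k

theorem memLp_rep (p : ℝ) (g : SE2) (φ : L2Circle) :
    MemLp (fun α : Angle =>
      Complex.exp (-Complex.I * p * (inner ℝ (unitVec α) g.trans : ℝ)) * φ (α - g.rot)) 2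
      AddCircle.haarAddCircle := by
  have h1 : MemLp (fun α : Angle => φ (α - g.rot)) 2 AddCircle.haarAddCircle :=
    (Lp.memLp φ).comp_measurePreserving (measurePreserving_sub_right _ g.rot)
  have hc : Continuous fun α : Angle =>
      Complex.exp (-Complex.I * p * (inner ℝ (unitVec α) g.trans : ℝ)) := by
    have := continuous_unitVec
    fun_prop
  refine MemLp.of_le h1 (hc.aestronglyMeasurable.mul h1.1) (Filter.Eventually.of_forall fun α => ?_)
  rw [norm_mul, Complex.norm_exp]
  simp

/-- The representation `[U_p(g) φ](u) = e^{-ip⟨u, x⟩} φ(R_θᵀ u)` on `L²(𝕊¹)`,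
for `g = (x, R_θ)`. -/
def rep (p : ℝ) (g : SE2) (φ : L2Circle) : L2Circle := (memLp_rep p g φ).toLp

/-- The operator `f̂(p) = ∫ f(g) U_p(g⁻¹) dg` on `L²(𝕊¹)`, for `dg = c dx₁ dx₂ dθ`. -/
def fourierOp (c : ℝ) (f : SE2 → ℂ) (p : ℝ) (φ : L2Circle) : L2Circle :=
  ∫ g, f g • rep p g⁻¹ φ ∂(haar c)

/-- The matrix element `f̂(p)_{nm} = ⟨f̂(p) e_n, e_m⟩`. The inner product of `L²(𝕊¹)` is linear in
the first argument in this notation and in the second one in Mathlib's. -/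
def fourierEntry (c : ℝ) (f : SE2 → ℂ) (p : ℝ) (n m : ℤ) : ℂ :=
  inner ℂ (basisFun m) (fourierOp c f p (basisFun n))

/-- The one-dimensional representation `χ_n(g) = e^{inθ}`, for `g = (x, R_θ)`. -/
def character (n : ℤ) (g : SE2) : ℂ := fourier n g.rot

/-- The Fourier transform `f̂[n] = ∫ f(g) conj χ_n(g) dg`, for `dg = c dx₁ dx₂ dθ`. -/
def fourierChar (c : ℝ) (f : SE2 → ℂ) (n : ℤ) : ℂ :=
  ∫ g, f g * (starRingEnd ℂ) (character n g) ∂(haar c)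

/-! ### Polar coordinates of the nonzero integral vectors -/

/-- The set of the lengths `ρ = √(k₁² + k₂²)` of the nonzero integral vectors. -/
def radii : Set ℝ := {ρ | 0 < ρ ∧ ∃ k₁ k₂ : ℤ, ρ = √((k₁ : ℝ) ^ 2 + (k₂ : ℝ) ^ 2)}

/-- The set `Θ_ρ` of the polar angles in `[0, 2π)` of the integral vectors of length `ρ`. -/
def angles (ρ : ℝ) : Set ℝ :=
  {θ | θ ∈ Set.Ico 0 (2 * Real.pi) ∧ ∃ k₁ k₂ : ℤ, ρ = √((k₁ : ℝ) ^ 2 + (k₂ : ℝ) ^ 2) ∧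
    (k₁ : ℝ) = ρ * Real.cos θ ∧ (k₂ : ℝ) = ρ * Real.sin θ}

/-- The terms `e^{-inθ} f̂(2πρ)_{nm}`, `n ∈ ℤ`, of the inner series. -/
def seriesTerm (c : ℝ) (f : SE2 → ℂ) (ρ θ : ℝ) (m n : ℤ) : ℂ :=
  Complex.exp (-Complex.I * n * θ) * fourierEntry c f (2 * Real.pi * ρ) n m

end SE2Plancherel

end

open MeasureTheory
open scoped ENNReal

noncomputable section

namespace SE2Plancherel

/-! ### Van der Corput estimates -/

section VanDerCorput

open Set

/-! The coset space is the torus (ℝ/ℤ)² × SO(2). For its normalized measure the functions χ(x, φ) =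
e^{2πi(k₁x₁ + k₂x₂)} e^{imφ} (`latticeChar`) form an orthonormal basis. They are Γ-invariant, so
unfolding turns the coefficients of the periodization into integrals ∫ f χ dg over SE(2), and
Parseval (`parseval_periodize`) gives 2πc ‖f̃‖² = ∑ |∫ f χ dg|². The terms with k = 0 are the
|f̂[-m]|².

For k = ρ u_θ ≠ 0 the factor e^{2πi⟨k,x⟩} is the plane wave β ↦ e^{2πiρ⟨u_β,x⟩} at β = θ. Let c_j(x)
be the Fourier coefficients of that wave in β. A direct computation gives f̂(2πρ)_{nm} = ∫ f(g)
e^{imφ} c_{m-n}(x) dg, so the series ∑ₙ e^{-inθ} f̂(2πρ)_{nm} is formally e^{-imθ} ∫ f χ dg. Polar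
coordinates on ℤ² \ {0} (`polarEquiv`) then regroup Parseval's sum into the stated one.

The exchange of sum and integral is the analytic core (`hasSum_seriesTerm`). The c_j are Bessel
functions up to phases, and ∑ |c_j(x)| is unbounded in x, so absolute convergence gives no majorant
for a merely integrable f. But the partial sums over intervals of indices are bounded uniformly in x
(`norm_sum_fourierCoeff_wave_le`), so dominated convergence applies to them.

For this bound, folding t and -t against the Dirichlet kernel leaves integrals of e^{iP cos t}
sin(λt + Q sin t) / sin(t/2) over (0, π). They are bounded uniformly in P, Q, λ
(`norm_integral_inv_sin_mul_oddPart_le`). Near 0 they resemble the sine integral. Away from 0 van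
der Corput's second and third derivative tests apply; these do not see λ, which enters the phase
only linearly. -/

theorem norm_cexp_I_mul_ofReal (x : ℝ) : ‖Complex.exp (Complex.I * x)‖ = 1 := by
  rw [mul_comm]; exact Complex.norm_exp_ofReal_mul_I x

/-- The centre `c` is a zero of `g` if there is one, and otherwise the endpoint where `g` is closest
to 0. The mean value inequality does the rest. For μ > 0 this bounds |g| below outside any window
around `c`, with a known sign on each side. -/
theorem exists_center_of_le_deriv {g g' : ℝ → ℝ} {a b μ : ℝ} (hab : a ≤ b)
    (hg : ∀ t, HasDerivAt g (g' t) t) (hμ : ∀ t ∈ Icc a b, μ ≤ g' t) :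
    ∃ c ∈ Icc a b, ∀ t ∈ Icc a b,
      (t < c → g t ≤ -(μ * (c - t))) ∧ (c < t → μ * (t - c) ≤ g t) := by
  have hcont : Continuous g := continuous_iff_continuousAt.2 fun t => (hg t).continuousAt
  have key : ∀ s ∈ Icc a b, ∀ t ∈ Icc a b, s ≤ t → μ * (t - s) ≤ g t - g s := by
    intro s hs t ht hst
    refine (convex_Icc a b).mul_sub_le_image_sub_of_le_deriv hcont.continuousOn
      (fun x _ => (hg x).differentiableAt.differentiableWithinAt) (fun x hx => ?_) s hs t ht hst
    rw [(hg x).deriv]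
    exact hμ x (interior_subset hx)
  have ha : a ∈ Icc a b := left_mem_Icc.2 hab
  have hb : b ∈ Icc a b := right_mem_Icc.2 hab
  have hmid : ∀ c ∈ Icc a b, (c ≠ a → g c ≤ 0) → (c ≠ b → 0 ≤ g c) → ∃ c ∈ Icc a b,
      ∀ t ∈ Icc a b, (t < c → g t ≤ -(μ * (c - t))) ∧ (c < t → μ * (t - c) ≤ g t) := by
    intro c hc h1 h2
    refine ⟨c, hc, fun t ht => ⟨fun htc => ?_, fun hct => ?_⟩⟩
    · have := key t ht c hc htc.le
      have := h1 (ht.1.trans_lt htc).ne'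
      linarith
    · have := key c hc t ht hct.le
      have := h2 (hct.trans_le ht.2).ne
      linarith
  rcases le_total 0 (g a) with h | h
  · exact hmid a ha (fun h => absurd rfl h) fun _ => h
  rcases le_total (g b) 0 with h' | h'
  · exact hmid b hb (fun _ => h') fun h => absurd rfl h
  obtain ⟨c, hc, hc0⟩ := intermediate_value_Icc hab hcont.continuousOn ⟨h, h'⟩
  exact hmid c hc (fun _ => hc0.le) fun _ => hc0.ge

/-- The induction step of van der Corput's method: the window of radius η around `c` is estimated
trivially by its length 2η, and each of the two outer pieces by A. -/
theorem norm_integral_le_of_avoid {F : ℝ → ℂ} (hF : Continuous F) (hF1 : ∀ t, ‖F t‖ ≤ 1)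
    {a b c η A : ℝ} (hη : 0 ≤ η) (hA : 0 ≤ A) (hc : c ∈ Icc a b)
    (h : ∀ x y, a ≤ x → x ≤ y → y ≤ b → (y ≤ c - η ∨ c + η ≤ x) → ‖∫ t in x..y, F t‖ ≤ A) :
    ‖∫ t in a..b, F t‖ ≤ 2 * A + 2 * η := by
  obtain ⟨hac, hcb⟩ := hc
  have hi : ∀ x y, IntervalIntegrable F volume x y := fun x y => hF.intervalIntegrable x y
  have h1 : ‖∫ t in a..(max a (c - η)), F t‖ ≤ A := by
    rcases le_total a (c - η) with h1 | h1
    · rw [max_eq_right h1]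
      exact h _ _ le_rfl h1 (by linarith) (Or.inl le_rfl)
    · rw [max_eq_left h1]; simpa using hA
  have h2 : ‖∫ t in (min b (c + η))..b, F t‖ ≤ A := by
    rcases le_total b (c + η) with h1 | h1
    · rw [min_eq_left h1]; simpa using hA
    · rw [min_eq_right h1]
      exact h _ _ (by linarith) h1 le_rfl (Or.inr le_rfl)
  have h3 : ‖∫ t in (max a (c - η))..(min b (c + η)), F t‖ ≤ 2 * η := by
    refine (intervalIntegral.norm_integral_le_of_norm_le_const fun t _ => hF1 t).trans ?_
    rw [one_mul, abs_of_nonneg]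
    · linarith [min_le_right b (c + η), le_max_right a (c - η)]
    · have : max a (c - η) ≤ c := max_le hac (by linarith)
      have : c ≤ min b (c + η) := le_min hcb (by linarith)
      linarith
  rw [← intervalIntegral.integral_add_adjacent_intervals (hi a (max a (c - η))) (hi _ b),
    ← intervalIntegral.integral_add_adjacent_intervals (hi _ (min b (c + η))) (hi _ b)]
  refine (norm_add_le _ _).trans ?_
  have := norm_add_le (∫ t in (max a (c - η))..(min b (c + η)), F t)
    (∫ t in (min b (c + η))..b, F t)
  linarith

variable {ψ ψ₁ ψ₂ ψ₃ : ℝ → ℝ} {a b η : ℝ}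

/-- Integration by parts, with e^{iψ} = ψ₁⁻¹ · (ψ₁ e^{iψ}). The boundary terms cost 2η. Since ψ₂ ≥
0, the derivative of ψ₁⁻¹ has constant sign, so the remainder is at most the total change of ψ₁⁻¹,
again 2η. Here and below η is the natural length scale: the k-th derivative is at least η⁻ᵏ in
absolute value. -/
theorem vanDerCorput_one (hab : a ≤ b) (h1 : ∀ t, HasDerivAt ψ (ψ₁ t) t)
    (h2 : ∀ t, HasDerivAt ψ₁ (ψ₂ t) t) (hc : Continuous ψ₂) (hη : 0 < η)
    (hlow : ∀ t ∈ Icc a b, η⁻¹ ≤ |ψ₁ t|) (hpos : ∀ t ∈ Icc a b, 0 ≤ ψ₂ t) :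
    ‖∫ t in a..b, Complex.exp (Complex.I * ψ t)‖ ≤ 4 * η := by
  have hψ : Continuous ψ := continuous_iff_continuousAt.2 fun t => (h1 t).continuousAt
  have hψ1 : Continuous ψ₁ := continuous_iff_continuousAt.2 fun t => (h2 t).continuousAt
  have hne : ∀ t ∈ Icc a b, ψ₁ t ≠ 0 := fun t ht h => by
    have := hlow t ht
    rw [h, abs_zero] at this
    exact absurd (inv_pos.2 hη) this.not_gt
  have hinv : ∀ t ∈ Icc a b, |(ψ₁ t)⁻¹| ≤ η := fun t ht => by
    rw [abs_inv]; exact inv_le_of_inv_le₀ hη (hlow t ht)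
  have hu : ∀ t ∈ Icc a b, HasDerivAt (fun t => (ψ₁ t)⁻¹) (-ψ₂ t / ψ₁ t ^ 2) t :=
    fun t ht => (h2 t).inv (hne t ht)
  have hu'c : ContinuousOn (fun t => -ψ₂ t / ψ₁ t ^ 2) (uIcc a b) := by
    rw [uIcc_of_le hab]
    exact hc.neg.continuousOn.div (hψ1.pow 2).continuousOn fun t ht => pow_ne_zero 2 (hne t ht)
  have hv : ∀ t, HasDerivAt (fun t => -Complex.I * Complex.exp (Complex.I * ψ t))
      (ψ₁ t * Complex.exp (Complex.I * ψ t)) t := fun t => by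
    have := (((h1 t).ofReal_comp.const_mul Complex.I).cexp).const_mul (-Complex.I)
    convert! this using 1
    linear_combination ((ψ₁ t : ℂ) * Complex.exp (Complex.I * ψ t)) * Complex.I_mul_I
  have hibp := intervalIntegral.integral_mul_deriv_eq_deriv_mul (a := a) (b := b)
    (u := fun t => (((ψ₁ t)⁻¹ : ℝ) : ℂ)) (u' := fun t => ((-ψ₂ t / ψ₁ t ^ 2 : ℝ) : ℂ))
    (v := fun t => -Complex.I * Complex.exp (Complex.I * ψ t))
    (v' := fun t => ψ₁ t * Complex.exp (Complex.I * ψ t))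
    (fun t ht => (hu t (by rwa [uIcc_of_le hab] at ht)).ofReal_comp) (fun t _ => hv t)
    ((Complex.continuous_ofReal.comp_continuousOn hu'c).intervalIntegrable)
    (Continuous.intervalIntegrable (by fun_prop) _ _)
  have hL : ∫ t in a..b, Complex.exp (Complex.I * ψ t) =
      ∫ t in a..b, (((ψ₁ t)⁻¹ : ℝ) : ℂ) * (ψ₁ t * Complex.exp (Complex.I * ψ t)) := by
    refine intervalIntegral.integral_congr fun t ht => ?_
    rw [uIcc_of_le hab] at ht
    have : (ψ₁ t : ℂ) ≠ 0 := by exact_mod_cast hne t ht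
    simp only [Complex.ofReal_inv]
    field_simp
  have hn : ∀ t, ‖-Complex.I * Complex.exp (Complex.I * ψ t)‖ = 1 := fun t => by
    rw [norm_mul, norm_cexp_I_mul_ofReal]; simp
  have hbd : ∀ t ∈ Icc a b,
      ‖(((ψ₁ t)⁻¹ : ℝ) : ℂ) * (-Complex.I * Complex.exp (Complex.I * ψ t))‖ ≤ η := fun t ht => by
    rw [norm_mul, hn, mul_one, Complex.norm_real]; exact hinv t ht
  have hrem : ‖∫ t in a..b, ((-ψ₂ t / ψ₁ t ^ 2 : ℝ) : ℂ) *
      (-Complex.I * Complex.exp (Complex.I * ψ t))‖ ≤ 2 * η := by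
    have hFTC := intervalIntegral.integral_eq_sub_of_hasDerivAt (a := a) (b := b)
      (fun t ht => hu t (by rwa [uIcc_of_le hab] at ht)) hu'c.intervalIntegrable
    have hle := intervalIntegral.norm_integral_le_of_norm_le (μ := volume) hab
      (f := fun t => ((-ψ₂ t / ψ₁ t ^ 2 : ℝ) : ℂ) *
        (-Complex.I * Complex.exp (Complex.I * ψ t))) (g := fun t => -(-ψ₂ t / ψ₁ t ^ 2))
      (Filter.Eventually.of_forall fun t ht => by
        rw [norm_mul, hn, mul_one, Complex.norm_real, Real.norm_eq_abs, abs_of_nonpos]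
        have := hpos t (Ioc_subset_Icc_self ht)
        exact div_nonpos_of_nonpos_of_nonneg (by linarith) (sq_nonneg _))
      hu'c.intervalIntegrable.neg
    rw [intervalIntegral.integral_neg, hFTC] at hle
    have h3 := abs_le.1 (hinv a (left_mem_Icc.2 hab))
    have h4 := abs_le.1 (hinv b (right_mem_Icc.2 hab))
    linarith [h3.2, h4.1]
  rw [hL, hibp]
  refine (norm_sub_le _ _).trans ?_
  have h5 := hbd a (left_mem_Icc.2 hab)
  have h6 := hbd b (right_mem_Icc.2 hab)
  have h7 := norm_sub_le
    ((((ψ₁ b)⁻¹ : ℝ) : ℂ) * (-Complex.I * Complex.exp (Complex.I * ψ b)))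
    ((((ψ₁ a)⁻¹ : ℝ) : ℂ) * (-Complex.I * Complex.exp (Complex.I * ψ a)))
  linarith

/-- The two integrals are complex conjugates. This reduces each derivative test to one sign. -/
theorem norm_integral_cexp_neg (ψ : ℝ → ℝ) (a b : ℝ) :
    ‖∫ t in a..b, Complex.exp (Complex.I * (-ψ t : ℝ))‖ =
      ‖∫ t in a..b, Complex.exp (Complex.I * ψ t)‖ := by
  rw [← RCLike.norm_conj (∫ t in a..b, Complex.exp (Complex.I * ψ t)),
    intervalIntegral, intervalIntegral, map_sub, ← integral_conj, ← integral_conj]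
  simp [← Complex.exp_conj]

theorem vanDerCorput_two_of_pos (hab : a ≤ b) (h1 : ∀ t, HasDerivAt ψ (ψ₁ t) t)
    (h2 : ∀ t, HasDerivAt ψ₁ (ψ₂ t) t) (hc : Continuous ψ₂) (hη : 0 < η)
    (hpos : ∀ t ∈ Icc a b, (η ^ 2)⁻¹ ≤ ψ₂ t) :
    ‖∫ t in a..b, Complex.exp (Complex.I * ψ t)‖ ≤ 10 * η := by
  have hψ : Continuous ψ := continuous_iff_continuousAt.2 fun t => (h1 t).continuousAt
  obtain ⟨c, hcm, hcc⟩ := exists_center_of_le_deriv hab h2 hpos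
  have hη2 : 0 < (η ^ 2)⁻¹ := by positivity
  have hmul : (η ^ 2)⁻¹ * η = η⁻¹ := by field_simp
  -- At distance η from the centre, |ψ₁| ≥ η⁻² · η = η⁻¹, so each outer piece is at most 4η; the
  -- total is 2 · 4η + 2η.
  refine (norm_integral_le_of_avoid (by fun_prop)
    (fun t => (norm_cexp_I_mul_ofReal _).le) hη.le (by positivity : 0 ≤ 4 * η) hcm
    fun x y hx hxy hy h => ?_).trans (by linarith)
  refine vanDerCorput_one hxy h1 h2 hc hη (fun t ht => ?_)
    fun t ht => hη2.le.trans (hpos t ⟨hx.trans ht.1, ht.2.trans hy⟩)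
  have := hcc t ⟨hx.trans ht.1, ht.2.trans hy⟩
  rw [← hmul]
  rcases h with h | h
  · have h3 := this.1 (by linarith [ht.2])
    rw [abs_of_nonpos (h3.trans (neg_nonpos.2 (mul_nonneg hη2.le (by linarith [ht.2]))))]
    have := mul_le_mul_of_nonneg_left (by linarith [ht.2] : η ≤ c - t) hη2.le
    linarith
  · have h3 := this.2 (by linarith [ht.1])
    have := mul_le_mul_of_nonneg_left (by linarith [ht.1] : η ≤ t - c) hη2.le
    exact (this.trans h3).trans (le_abs_self _)

theorem vanDerCorput_two (hab : a ≤ b) (h1 : ∀ t, HasDerivAt ψ (ψ₁ t) t)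
    (h2 : ∀ t, HasDerivAt ψ₁ (ψ₂ t) t) (hc : Continuous ψ₂) (hη : 0 < η)
    (h : (∀ t ∈ Icc a b, (η ^ 2)⁻¹ ≤ ψ₂ t) ∨ ∀ t ∈ Icc a b, ψ₂ t ≤ -(η ^ 2)⁻¹) :
    ‖∫ t in a..b, Complex.exp (Complex.I * ψ t)‖ ≤ 10 * η := by
  rcases h with h | h
  · exact vanDerCorput_two_of_pos hab h1 h2 hc hη h
  · rw [← norm_integral_cexp_neg]
    exact vanDerCorput_two_of_pos hab (fun t => (h1 t).neg) (fun t => (h2 t).neg) hc.neg hη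
      fun t ht => le_neg_of_le_neg (h t ht)

theorem vanDerCorput_three_of_pos (hab : a ≤ b) (h1 : ∀ t, HasDerivAt ψ (ψ₁ t) t)
    (h2 : ∀ t, HasDerivAt ψ₁ (ψ₂ t) t) (h3 : ∀ t, HasDerivAt ψ₂ (ψ₃ t) t) (hη : 0 < η)
    (hpos : ∀ t ∈ Icc a b, (η ^ 3)⁻¹ ≤ ψ₃ t) :
    ‖∫ t in a..b, Complex.exp (Complex.I * ψ t)‖ ≤ 22 * η := by
  have hψ : Continuous ψ := continuous_iff_continuousAt.2 fun t => (h1 t).continuousAt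
  have hψ2 : Continuous ψ₂ := continuous_iff_continuousAt.2 fun t => (h3 t).continuousAt
  obtain ⟨c, hcm, hcc⟩ := exists_center_of_le_deriv hab h3 hpos
  have hη3 : 0 < (η ^ 3)⁻¹ := by positivity
  have hmul : (η ^ 3)⁻¹ * η = (η ^ 2)⁻¹ := by field_simp
  -- The same reduction from order three to order two: 2 · 10η + 2η.
  refine (norm_integral_le_of_avoid (by fun_prop)
    (fun t => (norm_cexp_I_mul_ofReal _).le) hη.le (by positivity : 0 ≤ 10 * η) hcm
    fun x y hx hxy hy h => ?_).trans (by linarith)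
  refine vanDerCorput_two hxy h1 h2 hψ2 hη ?_
  rw [← hmul]
  rcases h with h | h
  · refine Or.inr fun t ht => ?_
    have h3 := (hcc t ⟨hx.trans ht.1, ht.2.trans hy⟩).1 (by linarith [ht.2])
    have := mul_le_mul_of_nonneg_left (by linarith [ht.2] : η ≤ c - t) hη3.le
    linarith
  · refine Or.inl fun t ht => ?_
    have h3 := (hcc t ⟨hx.trans ht.1, ht.2.trans hy⟩).2 (by linarith [ht.1])
    have := mul_le_mul_of_nonneg_left (by linarith [ht.1] : η ≤ t - c) hη3.le
    linarith

theorem vanDerCorput_three (hab : a ≤ b) (h1 : ∀ t, HasDerivAt ψ (ψ₁ t) t)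
    (h2 : ∀ t, HasDerivAt ψ₁ (ψ₂ t) t) (h3 : ∀ t, HasDerivAt ψ₂ (ψ₃ t) t) (hη : 0 < η)
    (h : (∀ t ∈ Icc a b, (η ^ 3)⁻¹ ≤ ψ₃ t) ∨ ∀ t ∈ Icc a b, ψ₃ t ≤ -(η ^ 3)⁻¹) :
    ‖∫ t in a..b, Complex.exp (Complex.I * ψ t)‖ ≤ 22 * η := by
  rcases h with h | h
  · exact vanDerCorput_three_of_pos hab h1 h2 h3 hη h
  · rw [← norm_integral_cexp_neg]
    exact vanDerCorput_three_of_pos hab (fun t => (h1 t).neg) (fun t => (h2 t).neg)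
      (fun t => (h3 t).neg) hη fun t ht => le_neg_of_le_neg (h t ht)

/-- Partial integration against the decreasing amplitude `1 / t`. -/
theorem norm_integral_inv_mul_le {F : ℝ → ℂ} (hF : Continuous F) {δ τ A : ℝ} (hδ : 0 < δ)
    (hδτ : δ ≤ τ) (h : ∀ y ∈ Icc δ τ, ‖∫ t in δ..y, F t‖ ≤ A) :
    ‖∫ t in δ..τ, ((t⁻¹ : ℝ) : ℂ) * F t‖ ≤ A / δ := by
  have hpos : ∀ t ∈ uIcc δ τ, 0 < t := fun t ht => by
    rw [uIcc_of_le hδτ] at ht; exact hδ.trans_le ht.1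
  have hu : ∀ t ∈ uIcc δ τ, HasDerivAt (fun t : ℝ => t⁻¹) (-(t ^ 2)⁻¹) t := fun t ht =>
    hasDerivAt_inv (hpos t ht).ne'
  have hu'c : ContinuousOn (fun t : ℝ => -(t ^ 2)⁻¹) (uIcc δ τ) :=
    ((continuousOn_id.pow 2).inv₀ fun t ht => pow_ne_zero 2 (hpos t ht).ne').neg
  have hibp := intervalIntegral.integral_mul_deriv_eq_deriv_mul (a := δ) (b := τ)
    (u := fun t => ((t⁻¹ : ℝ) : ℂ)) (u' := fun t => ((-(t ^ 2)⁻¹ : ℝ) : ℂ))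
    (v := fun y => ∫ t in δ..y, F t) (v' := F)
    (fun t ht => (hu t ht).ofReal_comp)
    (fun t _ => intervalIntegral.integral_hasDerivAt_right (hF.intervalIntegrable _ _)
      (hF.stronglyMeasurableAtFilter _ _) hF.continuousAt)
    ((Complex.continuous_ofReal.comp_continuousOn hu'c).intervalIntegrable)
    (hF.intervalIntegrable _ _)
  rw [hibp, intervalIntegral.integral_same, mul_zero, sub_zero]
  have hτ : 0 < τ := hδ.trans_le hδτ
  have h1 : ‖((τ⁻¹ : ℝ) : ℂ) * ∫ t in δ..τ, F t‖ ≤ τ⁻¹ * A := by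
    rw [norm_mul, Complex.norm_real, Real.norm_of_nonneg (by positivity)]
    exact mul_le_mul_of_nonneg_left (h τ (right_mem_Icc.2 hδτ)) (by positivity)
  have h2 := intervalIntegral.norm_integral_le_of_norm_le (μ := volume) hδτ
      (f := fun t => ((-(t ^ 2)⁻¹ : ℝ) : ℂ) * ∫ s in δ..t, F s)
      (g := fun t => -(t ^ 2)⁻¹ * -A)
      (Filter.Eventually.of_forall fun t ht => by
        rw [norm_mul, Complex.norm_real, norm_neg, neg_mul_neg,
          Real.norm_of_nonneg (by positivity)]
        exact mul_le_mul_of_nonneg_left (h t (Ioc_subset_Icc_self ht)) (by positivity))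
      (hu'c.mul continuousOn_const).intervalIntegrable
  rw [intervalIntegral.integral_mul_const,
    intervalIntegral.integral_eq_sub_of_hasDerivAt hu hu'c.intervalIntegrable] at h2
  refine (norm_sub_le _ _).trans ?_
  rw [div_eq_inv_mul]
  linarith

end VanDerCorput

/-! ### A uniformly bounded family of singular oscillatory integrals -/

section Oscillatory

open Set

/-- The phase `P cos t + Q sin t + λ t`. -/
def phase (P Q lam t : ℝ) : ℝ := P * Real.cos t + Q * Real.sin t + lam * t

theorem hasDerivAt_phase (P Q lam t : ℝ) :
    HasDerivAt (phase P Q lam) (-(P * Real.sin t) + Q * Real.cos t + lam) t := by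
  have := (((Real.hasDerivAt_cos t).const_mul P).add ((Real.hasDerivAt_sin t).const_mul Q)).add
    ((hasDerivAt_id t).const_mul lam)
  convert! this using 1
  ring

theorem hasDerivAt_phase_deriv (P Q lam t : ℝ) :
    HasDerivAt (fun t => -(P * Real.sin t) + Q * Real.cos t + lam)
      (-(P * Real.cos t) - Q * Real.sin t) t := by
  have := ((((Real.hasDerivAt_sin t).const_mul P).neg).add
    ((Real.hasDerivAt_cos t).const_mul Q)).add_const lam
  convert! this using 1
  ring

theorem hasDerivAt_phase_deriv_two (P Q t : ℝ) :
    HasDerivAt (fun t => -(P * Real.cos t) - Q * Real.sin t)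
      (P * Real.sin t - Q * Real.cos t) t := by
  have := (((Real.hasDerivAt_cos t).const_mul P).neg).sub ((Real.hasDerivAt_sin t).const_mul Q)
  convert! this using 1
  ring

theorem continuous_phase (P Q lam : ℝ) : Continuous (phase P Q lam) := by
  unfold phase; fun_prop

/-- The term P cos t dominates the second derivative, so the second derivative test bounds the
integrals without the factor t⁻¹ by a multiple of δ. Partial integration against t⁻¹ ≤ δ⁻¹ makes
this an absolute constant. -/
theorem norm_integral_phase_of_cos_dominant {P Q δ s : ℝ} (lam : ℝ) (hδ : 0 < δ) (hδs : δ ≤ s)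
    (hs : s ≤ 1 / 4) (hP : |P| * δ ^ 2 = 1) (hQ : |Q| * s ≤ |P| / 2) :
    ‖∫ t in δ..s, ((t⁻¹ : ℝ) : ℂ) * Complex.exp (Complex.I * phase P Q lam t)‖ ≤ 20 := by
  have hc := continuous_phase P Q lam
  -- The test is applied with η = 2δ: the second derivative is at least (31/32 - 1/2)|P| ≥ |P|/4 in
  -- absolute value.
  have hη : ((2 * δ) ^ 2)⁻¹ = |P| / 4 := by
    have : |P| = (δ ^ 2)⁻¹ := eq_inv_of_mul_eq_one_left hP
    rw [this]; field_simp; norm_num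
  have hcos : ∀ t ∈ Icc δ s, 31 / 32 ≤ Real.cos t := fun t ht => by
    have := Real.one_sub_sq_div_two_le_cos (x := t)
    nlinarith [ht.1, ht.2]
  have hsin : ∀ t ∈ Icc δ s, |Q * Real.sin t| ≤ |P| / 2 := fun t ht => by
    have h0 : 0 < t := hδ.trans_le ht.1
    rw [abs_mul]
    have h1 : |Real.sin t| ≤ s := Real.abs_sin_le_abs.trans (by rw [abs_of_pos h0]; exact ht.2)
    exact (mul_le_mul_of_nonneg_left h1 (abs_nonneg Q)).trans hQ
  have key : ∀ y ∈ Icc δ s, ‖∫ t in δ..y, Complex.exp (Complex.I * phase P Q lam t)‖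
      ≤ 10 * (2 * δ) := fun y hy => by
    refine vanDerCorput_two hy.1 (hasDerivAt_phase P Q lam) (hasDerivAt_phase_deriv P Q lam)
      (by fun_prop) (by positivity) ?_
    rw [hη]
    rcases le_total 0 P with h | h
    · refine Or.inr fun t ht => ?_
      have h1 := hcos t ⟨ht.1, ht.2.trans hy.2⟩
      have h2 := abs_le.1 (hsin t ⟨ht.1, ht.2.trans hy.2⟩)
      rw [abs_of_nonneg h] at *
      nlinarith [h2.1]
    · refine Or.inl fun t ht => ?_
      have h1 := hcos t ⟨ht.1, ht.2.trans hy.2⟩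
      have h2 := abs_le.1 (hsin t ⟨ht.1, ht.2.trans hy.2⟩)
      rw [abs_of_nonpos h] at *
      nlinarith [h2.2]
  refine (norm_integral_inv_mul_le (by fun_prop) hδ hδs key).trans_eq ?_
  field_simp
  norm_num

/-- The second derivative may vanish here, but Q cos t dominates the third one, where (31/32 -
1/4)|Q| ≥ |Q|/8. The third derivative test with η = 2σ gives 22 · 2σ, and dividing by σ/2 gives 88.
-/
theorem norm_integral_phase_of_sin_dominant {P Q σ : ℝ} (lam : ℝ) (hσ : 0 < σ)
    (hs : σ / 2 ≤ 1 / 4) (hQ : |Q| * σ ^ 3 = 1) (hP : |P| ≤ |Q|) :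
    ‖∫ t in (σ / 2)..(1 / 4), ((t⁻¹ : ℝ) : ℂ) * Complex.exp (Complex.I * phase P Q lam t)‖
      ≤ 88 := by
  have hc := continuous_phase P Q lam
  have hη : ((2 * σ) ^ 3)⁻¹ = |Q| / 8 := by
    have : |Q| = (σ ^ 3)⁻¹ := eq_inv_of_mul_eq_one_left hQ
    rw [this]; field_simp; norm_num
  have hcos : ∀ t ∈ Icc (σ / 2) (1 / 4), 31 / 32 ≤ Real.cos t := fun t ht => by
    have := Real.one_sub_sq_div_two_le_cos (x := t)
    have h0 : 0 < t := (half_pos hσ).trans_le ht.1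
    nlinarith [ht.2]
  have hsin : ∀ t ∈ Icc (σ / 2) (1 / 4), |P * Real.sin t| ≤ |Q| / 4 := fun t ht => by
    have h0 : 0 < t := (half_pos hσ).trans_le ht.1
    rw [abs_mul]
    have h1 : |Real.sin t| ≤ 1 / 4 := Real.abs_sin_le_abs.trans (by rw [abs_of_pos h0]; exact ht.2)
    calc |P| * |Real.sin t| ≤ |Q| * (1 / 4) := by gcongr
      _ = _ := by ring
  have key : ∀ y ∈ Icc (σ / 2) (1 / 4),
      ‖∫ t in (σ / 2)..y, Complex.exp (Complex.I * phase P Q lam t)‖ ≤ 22 * (2 * σ) :=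
    fun y hy => by
    refine vanDerCorput_three hy.1 (hasDerivAt_phase P Q lam) (hasDerivAt_phase_deriv P Q lam)
      (hasDerivAt_phase_deriv_two P Q) (by positivity) ?_
    rw [hη]
    rcases le_total 0 Q with h | h
    · refine Or.inr fun t ht => ?_
      have h1 := hcos t ⟨ht.1, ht.2.trans hy.2⟩
      have h2 := abs_le.1 (hsin t ⟨ht.1, ht.2.trans hy.2⟩)
      rw [abs_of_nonneg h] at *
      nlinarith [h2.2]
    · refine Or.inl fun t ht => ?_
      have h1 := hcos t ⟨ht.1, ht.2.trans hy.2⟩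
      have h2 := abs_le.1 (hsin t ⟨ht.1, ht.2.trans hy.2⟩)
      rw [abs_of_nonpos h] at *
      nlinarith [h2.1]
  refine (norm_integral_inv_mul_le (by fun_prop) (half_pos hσ) hs key).trans_eq ?_
  field_simp
  norm_num

theorem intervalIntegrable_inv_mul_of_pos {F : ℝ → ℂ} (hF : Continuous F) {x y : ℝ} (hx : 0 < x)
    (hy : 0 < y) : IntervalIntegrable (fun t => ((t⁻¹ : ℝ) : ℂ) * F t) volume x y := by
  refine ContinuousOn.intervalIntegrable ?_
  refine ContinuousOn.mul (Complex.continuous_ofReal.comp_continuousOn ?_) hF.continuousOn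
  exact continuousOn_id.inv₀ fun t ht => ((lt_min hx hy).trans_le ht.1).ne'

/-- The cutoff δ is of order min(|P|^{-1/2}, |Q|^{-1/3}) when these are small: below it the phase is
linear up to a bounded error, above it the derivative tests apply. One δ has to serve all λ and both
signs of Q, because `oddPart` is a difference of two exponentials with opposite Q and λ. -/
theorem exists_cutoff (P Q : ℝ) : ∃ δ : ℝ, 0 < δ ∧ δ ≤ 1 / 4 ∧ |P| * δ ^ 2 ≤ 1 ∧ |Q| * δ ^ 3 ≤ 1 ∧
    ∀ Q' lam : ℝ, |Q'| = |Q| →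
      ‖∫ t in δ..(1 / 4), ((t⁻¹ : ℝ) : ℂ) * Complex.exp (Complex.I * phase P Q' lam t)‖
        ≤ 108 := by
  have hsqrt : ∀ x : ℝ, 0 < x → ∃ δ : ℝ, 0 < δ ∧ x * δ ^ 2 = 1 := fun x hx => by
    refine ⟨(√x)⁻¹, by positivity, ?_⟩
    rw [inv_pow, Real.sq_sqrt hx.le, mul_inv_cancel₀ hx.ne']
  have hcbrt : ∀ x : ℝ, 0 < x → ∃ σ : ℝ, 0 < σ ∧ x * σ ^ 3 = 1 := fun x hx => by
    refine ⟨x ^ (-(1 / 3) : ℝ), by positivity, ?_⟩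
    rw [← Real.rpow_natCast, ← Real.rpow_mul hx.le]
    norm_num
    rw [Real.rpow_neg_one, mul_inv_cancel₀ hx.ne']
  have hfar : |P| ≤ 16 → |Q| ≤ 16 → ∃ δ : ℝ, 0 < δ ∧ δ ≤ 1 / 4 ∧ |P| * δ ^ 2 ≤ 1 ∧
      |Q| * δ ^ 3 ≤ 1 ∧ ∀ Q' lam : ℝ, |Q'| = |Q| →
      ‖∫ t in δ..(1 / 4), ((t⁻¹ : ℝ) : ℂ) * Complex.exp (Complex.I * phase P Q' lam t)‖
        ≤ 108 := fun h1 h2 =>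
    -- For small P and Q the cutoff 1/4 leaves an empty interval.
    ⟨1 / 4, by norm_num, le_rfl, by linarith, by linarith, fun Q' lam _ => by simp⟩
  rcases le_total |Q| |P| with hQP | hPQ
  · by_cases hP : |P| ≤ 16
    · exact hfar hP (hQP.trans hP)
    rw [not_le] at hP
    obtain ⟨δ, hδ, hPδ⟩ := hsqrt |P| (by linarith)
    have hδ4 : δ ≤ 1 / 4 := by
      by_contra! h
      nlinarith
    refine ⟨δ, hδ, hδ4, hPδ.le, ?_, fun Q' lam hQ' => ?_⟩
    · calc |Q| * δ ^ 3 = |Q| * δ ^ 2 * δ := by ring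
        _ ≤ |P| * δ ^ 2 * 1 := by gcongr; linarith
        _ = 1 := by rw [hPδ, one_mul]
    · refine (norm_integral_phase_of_cos_dominant lam hδ hδ4 le_rfl hPδ ?_).trans (by norm_num)
      rw [hQ']; linarith [abs_nonneg Q]
  · by_cases hQ : |Q| ≤ 16
    · exact hfar (hPQ.trans hQ) hQ
    rw [not_le] at hQ
    obtain ⟨σ, hσ, hQσ⟩ := hcbrt |Q| (by linarith)
    have hσ4 : σ / 2 ≤ 1 / 4 := by
      by_contra! h
      have : (1 / 2 : ℝ) ^ 3 ≤ σ ^ 3 := by gcongr; linarith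
      nlinarith
    -- Now Q dominates and σ = |Q|^{-1/3}. If |P|^{-1/2} is at least σ/2, the third derivative test
    -- alone suffices. Otherwise the cutoff is |P|^{-1/2}, with the second derivative test up to σ/2
    -- and the third one beyond.
    by_cases hP : |P| * (σ / 2) ^ 2 ≤ 1
    · refine ⟨σ / 2, half_pos hσ, hσ4, hP, ?_, fun Q' lam hQ' => ?_⟩
      · rw [div_pow, ← mul_div_assoc, hQσ]; norm_num
      · exact (norm_integral_phase_of_sin_dominant lam hσ hσ4 (by rw [hQ', hQσ])
          (by rwa [hQ'])).trans (by norm_num)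
    rw [not_le] at hP
    have hP0 : 0 < |P| := by
      by_contra! h
      nlinarith [sq_nonneg (σ / 2)]
    obtain ⟨δ, hδ, hPδ⟩ := hsqrt |P| hP0
    have hδσ : δ ≤ σ / 2 := by
      have : δ ^ 2 < (σ / 2) ^ 2 := lt_of_mul_lt_mul_left (hPδ.trans_lt hP) hP0.le
      exact (lt_of_pow_lt_pow_left₀ 2 (half_pos hσ).le this).le
    refine ⟨δ, hδ, hδσ.trans hσ4, hPδ.le, ?_, fun Q' lam hQ' => ?_⟩
    · calc |Q| * δ ^ 3 ≤ |Q| * σ ^ 3 := by gcongr; linarith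
        _ = 1 := hQσ
    · have hc : Continuous fun t => Complex.exp (Complex.I * phase P Q' lam t) := by
        have := continuous_phase P Q' lam
        fun_prop
      rw [← intervalIntegral.integral_add_adjacent_intervals
        (intervalIntegrable_inv_mul_of_pos hc hδ (half_pos hσ))
        (intervalIntegrable_inv_mul_of_pos hc (half_pos hσ) (by norm_num))]
      have h1 := norm_integral_phase_of_cos_dominant (P := P) (Q := Q') lam hδ hδσ hσ4 hPδ (by
        rw [hQ']
        have : |Q| * (σ / 2) = (4 * (|P| * (σ / 2) ^ 2))⁻¹ * (|Q| * σ ^ 3) * (|P| / 2) := by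
          field_simp; norm_num
        rw [this, hQσ, mul_one]
        have : (4 * (|P| * (σ / 2) ^ 2))⁻¹ ≤ 1 := inv_le_one_of_one_le₀ (by linarith)
        nlinarith)
      have h2 := norm_integral_phase_of_sin_dominant (P := P) (Q := Q') lam hσ hσ4
        (by rw [hQ', hQσ]) (by rwa [hQ'])
      exact (norm_add_le _ _).trans (by linarith)

theorem intervalIntegrable_of_norm_le {F : ℝ → ℂ} (hF : Measurable F) {a b C : ℝ} (hab : a ≤ b)
    (h : ∀ t ∈ Ioc a b, ‖F t‖ ≤ C) : IntervalIntegrable F volume a b := by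
  rw [intervalIntegrable_iff_integrableOn_Ioc_of_le hab]
  exact Measure.integrableOn_of_bounded (M := C) (by simp) hF.aestronglyMeasurable
    ((ae_restrict_iff' measurableSet_Ioc).2 (Filter.Eventually.of_forall h))

/-- Up to 1/|B| the integrand is at most |B|, which contributes at most 1. Beyond that, the
integrals of sin(Bt) are at most 2/|B|, and partial integration against t⁻¹ ≤ |B| contributes at
most 2. -/
theorem norm_integral_sin_div_le (B : ℝ) {δ : ℝ} (hδ : 0 < δ) :
    ‖∫ t in (0 : ℝ)..δ, ((t⁻¹ : ℝ) : ℂ) * (Real.sin (B * t) : ℂ)‖ ≤ 3 := by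
  have hbd : ∀ t : ℝ, 0 < t → ‖((t⁻¹ : ℝ) : ℂ) * (Real.sin (B * t) : ℂ)‖ ≤ |B| := fun t ht => by
    rw [norm_mul, Complex.norm_real, Complex.norm_real, Real.norm_of_nonneg (by positivity),
      inv_mul_le_iff₀ ht, Real.norm_eq_abs]
    refine Real.abs_sin_le_abs.trans_eq ?_
    rw [abs_mul, abs_of_pos ht, mul_comm]
  rcases eq_or_ne B 0 with rfl | hB
  · simp
  have hB' : 0 < |B| := abs_pos.2 hB
  set x := min δ |B|⁻¹ with hx
  have hx0 : 0 < x := lt_min hδ (by positivity)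
  have hxδ : x ≤ δ := min_le_left _ _
  have hFc : Continuous fun t => (Real.sin (B * t) : ℂ) := by fun_prop
  have hm : Measurable fun t => ((t⁻¹ : ℝ) : ℂ) * (Real.sin (B * t) : ℂ) :=
    (Complex.measurable_ofReal.comp measurable_inv).mul hFc.measurable
  rw [← intervalIntegral.integral_add_adjacent_intervals
    (intervalIntegrable_of_norm_le hm hx0.le fun t ht => hbd t ht.1)
    (intervalIntegrable_inv_mul_of_pos hFc hx0 hδ)]
  have h1 : ‖∫ t in (0 : ℝ)..x, ((t⁻¹ : ℝ) : ℂ) * (Real.sin (B * t) : ℂ)‖ ≤ 1 := by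
    refine (intervalIntegral.norm_integral_le_of_norm_le_const fun t ht => hbd t ?_).trans ?_
    · rw [uIoc_of_le hx0.le] at ht; exact ht.1
    · rw [sub_zero, abs_of_pos hx0]
      calc |B| * x ≤ |B| * |B|⁻¹ := by gcongr; exact min_le_right _ _
        _ = 1 := mul_inv_cancel₀ hB'.ne'
  have h2 : ‖∫ t in x..δ, ((t⁻¹ : ℝ) : ℂ) * (Real.sin (B * t) : ℂ)‖ ≤ 2 := by
    rcases le_total δ |B|⁻¹ with h | h
    · rw [hx, min_eq_left h]; simp
    have hxB : x = |B|⁻¹ := min_eq_right h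
    refine (norm_integral_inv_mul_le hFc hx0 hxδ (A := 2 * |B|⁻¹) fun y hy => ?_).trans_eq ?_
    · rw [intervalIntegral.integral_ofReal, Complex.norm_real,
        intervalIntegral.integral_comp_mul_left (fun u => Real.sin u) hB, integral_sin, smul_eq_mul,
        norm_mul, norm_inv, Real.norm_eq_abs, Real.norm_eq_abs, mul_comm]
      gcongr
      have h3 := Real.cos_le_one (B * x)
      have h4 := Real.cos_le_one (B * y)
      have h5 := Real.neg_one_le_cos (B * x)
      have h6 := Real.neg_one_le_cos (B * y)
      exact abs_le.2 ⟨by linarith, by linarith⟩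
    · rw [hxB]; field_simp
  exact (norm_add_le _ _).trans (by linarith)

/-- The odd part of an oscillating function with the phase `P cos t + Q sin t + λ t`. -/
def oddPart (P Q lam t : ℝ) : ℂ :=
  Complex.exp (Complex.I * (P * Real.cos t : ℝ)) * (Real.sin (lam * t + Q * Real.sin t) : ℂ)

theorem continuous_oddPart (P Q lam : ℝ) : Continuous (oddPart P Q lam) := by
  unfold oddPart; fun_prop

theorem norm_oddPart_le (P Q lam t : ℝ) : ‖oddPart P Q lam t‖ ≤ 1 := by
  rw [oddPart, norm_mul, norm_cexp_I_mul_ofReal, one_mul, Complex.norm_real]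
  exact Real.abs_sin_le_one _

theorem norm_oddPart_le_mul (P Q lam : ℝ) {t : ℝ} (ht : 0 < t) :
    ‖oddPart P Q lam t‖ ≤ (|lam| + |Q|) * t := by
  rw [oddPart, norm_mul, norm_cexp_I_mul_ofReal, one_mul, Complex.norm_real]
  refine Real.abs_sin_le_abs.trans ((abs_add_le _ _).trans ?_)
  rw [abs_mul, abs_mul, abs_of_pos ht, add_mul]
  have : |Real.sin t| ≤ t := Real.abs_sin_le_abs.trans_eq (abs_of_pos ht)
  gcongr

theorem oddPart_eq (P Q lam t : ℝ) : oddPart P Q lam t = (2 * Complex.I)⁻¹ *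
    (Complex.exp (Complex.I * phase P Q lam t) -
      Complex.exp (Complex.I * phase P (-Q) (-lam) t)) := by
  have h1 : Complex.exp (Complex.I * phase P Q lam t) =
      Complex.exp (Complex.I * (P * Real.cos t : ℝ)) *
        Complex.exp ((lam * t + Q * Real.sin t : ℝ) * Complex.I) := by
    rw [← Complex.exp_add, phase]; congr 1; push_cast; ring
  have h2 : Complex.exp (Complex.I * phase P (-Q) (-lam) t) =
      Complex.exp (Complex.I * (P * Real.cos t : ℝ)) *
        Complex.exp (-(lam * t + Q * Real.sin t : ℝ) * Complex.I) := by
    rw [← Complex.exp_add, phase]; congr 1; push_cast; ring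
  have h3 : (2 * Complex.I)⁻¹ = -Complex.I / 2 := by rw [mul_inv, Complex.inv_I]; ring
  rw [oddPart, h1, h2, h3, Complex.ofReal_sin, Complex.sin]
  ring

/-- The comparison function freezes cos t at 1 and replaces sin t by t. The two errors come from 1 -
cos t ≤ t²/2 and t - sin t ≤ t³/4. -/
theorem norm_oddPart_sub_le (P Q lam : ℝ) {t : ℝ} (ht : 0 < t) :
    ‖oddPart P Q lam t - Complex.exp (Complex.I * P) * (Real.sin ((lam + Q) * t) : ℂ)‖
      ≤ |P| * t ^ 2 / 2 + |Q| * t ^ 3 / 4 := by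
  have hsplit : oddPart P Q lam t - Complex.exp (Complex.I * P) * (Real.sin ((lam + Q) * t) : ℂ) =
      Complex.exp (Complex.I * P) * (Complex.exp (Complex.I * (P * (Real.cos t - 1) : ℝ)) - 1) *
        (Real.sin (lam * t + Q * Real.sin t) : ℂ) +
      Complex.exp (Complex.I * P) *
        ((Real.sin (lam * t + Q * Real.sin t) - Real.sin ((lam + Q) * t) : ℝ) : ℂ) := by
    have : Complex.exp (Complex.I * (P * Real.cos t : ℝ)) =
        Complex.exp (Complex.I * P) * Complex.exp (Complex.I * (P * (Real.cos t - 1) : ℝ)) := by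
      rw [← Complex.exp_add]; congr 1; push_cast; ring
    rw [oddPart, this]
    push_cast
    ring
  rw [hsplit]
  refine (norm_add_le _ _).trans (add_le_add ?_ ?_)
  · rw [norm_mul, norm_mul, norm_cexp_I_mul_ofReal, one_mul, Complex.norm_real]
    have h1 := Real.norm_exp_I_mul_ofReal_sub_one_le (x := P * (Real.cos t - 1))
    have h2 : ‖P * (Real.cos t - 1)‖ ≤ |P| * t ^ 2 / 2 := by
      rw [norm_mul, Real.norm_eq_abs, Real.norm_eq_abs, mul_div_assoc]
      gcongr
      rw [abs_of_nonpos (by linarith [Real.cos_le_one t])]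
      linarith [Real.one_sub_sq_div_two_le_cos (x := t)]
    calc _ ≤ (|P| * t ^ 2 / 2) * 1 := by
          gcongr
          · exact h1.trans h2
          · exact Real.abs_sin_le_one _
      _ = _ := mul_one _
  · rw [norm_mul, norm_cexp_I_mul_ofReal, one_mul, Complex.norm_real, Real.norm_eq_abs]
    have h1 : |Real.sin (lam * t + Q * Real.sin t) - Real.sin ((lam + Q) * t)| ≤
        |lam * t + Q * Real.sin t - (lam + Q) * t| := by
      have := Real.lipschitzWith_sin.dist_le_mul (lam * t + Q * Real.sin t) ((lam + Q) * t)
      simpa [Real.dist_eq] using this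
    refine h1.trans ?_
    rw [show lam * t + Q * Real.sin t - (lam + Q) * t = Q * (Real.sin t - t) by ring, abs_mul,
      mul_div_assoc]
    gcongr
    rw [abs_of_nonpos (by linarith [Real.sin_lt ht])]
    linarith [Real.sin_gt_sub_cube ht, pow_pos ht 3]

/-- The bound is 4 + 108 + 20, from the pieces (0, δ], [δ, 1/4] and [1/4, π] with δ from
`exists_cutoff`. -/
theorem norm_integral_inv_mul_oddPart_le (P Q lam : ℝ) :
    ‖∫ t in (0 : ℝ)..Real.pi, ((t⁻¹ : ℝ) : ℂ) * oddPart P Q lam t‖ ≤ 132 := by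
  obtain ⟨δ, hδ, hδ4, hP, hQ, htail⟩ := exists_cutoff P Q
  have hc := continuous_oddPart P Q lam
  have hpi := Real.pi_gt_three
  have hbd : ∀ t : ℝ, 0 < t → ‖((t⁻¹ : ℝ) : ℂ) * oddPart P Q lam t‖ ≤ |lam| + |Q| :=
    fun t ht => by
    rw [norm_mul, Complex.norm_real, Real.norm_of_nonneg (by positivity), inv_mul_le_iff₀ ht,
      mul_comm]
    exact norm_oddPart_le_mul P Q lam ht
  have hm : Measurable fun t => ((t⁻¹ : ℝ) : ℂ) * oddPart P Q lam t :=
    (Complex.measurable_ofReal.comp measurable_inv).mul hc.measurable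
  have hi1 := intervalIntegrable_of_norm_le hm hδ.le fun t ht => hbd t ht.1
  have hi2 := intervalIntegrable_inv_mul_of_pos hc hδ (by norm_num : (0 : ℝ) < 1 / 4)
  have hi3 := intervalIntegrable_inv_mul_of_pos hc (by norm_num : (0 : ℝ) < 1 / 4) Real.pi_pos
  rw [← intervalIntegral.integral_add_adjacent_intervals (hi1.trans hi2) hi3,
    ← intervalIntegral.integral_add_adjacent_intervals hi1 hi2]
  have h1 : ‖∫ t in (0 : ℝ)..δ, ((t⁻¹ : ℝ) : ℂ) * oddPart P Q lam t‖ ≤ 4 := by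
    have hm' : Measurable fun t => ((t⁻¹ : ℝ) : ℂ) * (Real.sin ((lam + Q) * t) : ℂ) :=
      (Complex.measurable_ofReal.comp measurable_inv).mul
        (Continuous.measurable (by fun_prop))
    have hi4 : IntervalIntegrable (fun t => ((t⁻¹ : ℝ) : ℂ) * (Real.sin ((lam + Q) * t) : ℂ))
        volume 0 δ := intervalIntegrable_of_norm_le hm' hδ.le (C := |lam + Q|) fun t ht => by
      rw [norm_mul, Complex.norm_real, Complex.norm_real,
        Real.norm_of_nonneg (inv_nonneg.2 ht.1.le), inv_mul_le_iff₀ ht.1, Real.norm_eq_abs]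
      refine Real.abs_sin_le_abs.trans_eq ?_
      rw [abs_mul, abs_of_pos ht.1, mul_comm]
    have hdec : ∫ t in (0 : ℝ)..δ, ((t⁻¹ : ℝ) : ℂ) * oddPart P Q lam t =
        (∫ t in (0 : ℝ)..δ, (((t⁻¹ : ℝ) : ℂ) * oddPart P Q lam t - Complex.exp (Complex.I * P) *
          (((t⁻¹ : ℝ) : ℂ) * (Real.sin ((lam + Q) * t) : ℂ)))) +
        Complex.exp (Complex.I * P) *
          ∫ t in (0 : ℝ)..δ, ((t⁻¹ : ℝ) : ℂ) * (Real.sin ((lam + Q) * t) : ℂ) := by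
      rw [intervalIntegral.integral_sub hi1 (hi4.const_mul _),
        intervalIntegral.integral_const_mul]
      ring
    rw [hdec]
    refine (norm_add_le _ _).trans ?_
    rw [norm_mul, norm_cexp_I_mul_ofReal, one_mul]
    have h5 := norm_integral_sin_div_le (lam + Q) hδ
    refine (add_le_add (b := 1) ?_ h5).trans (by norm_num)
    -- The choice of δ gives |P|t² ≤ t/δ and |Q|t³ ≤ t/δ on (0, δ], so the error divided by t is at
    -- most 1/δ.
    refine (intervalIntegral.norm_integral_le_of_norm_le_const (C := δ⁻¹) fun t ht => ?_).trans ?_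
    · rw [uIoc_of_le hδ.le] at ht
      have ht0 := ht.1
      rw [show ((t⁻¹ : ℝ) : ℂ) * oddPart P Q lam t - Complex.exp (Complex.I * P) *
          (((t⁻¹ : ℝ) : ℂ) * (Real.sin ((lam + Q) * t) : ℂ)) = ((t⁻¹ : ℝ) : ℂ) *
          (oddPart P Q lam t - Complex.exp (Complex.I * P) * (Real.sin ((lam + Q) * t) : ℂ)) by
        ring, norm_mul, Complex.norm_real, Real.norm_of_nonneg (by positivity),
        inv_mul_le_iff₀ ht0]
      refine (norm_oddPart_sub_le P Q lam ht0).trans ?_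
      have e1 : |P| * t ^ 2 ≤ t * δ⁻¹ := by
        calc |P| * t ^ 2 = |P| * t * t := by ring
          _ ≤ |P| * δ * t := by gcongr; exact ht.2
          _ = |P| * δ ^ 2 * (t * δ⁻¹) := by field_simp
          _ ≤ 1 * (t * δ⁻¹) := by gcongr
          _ = t * δ⁻¹ := one_mul _
      have e2 : |Q| * t ^ 3 ≤ t * δ⁻¹ := by
        calc |Q| * t ^ 3 = |Q| * t ^ 2 * t := by ring
          _ ≤ |Q| * δ ^ 2 * t := by gcongr; exact ht.2
          _ = |Q| * δ ^ 3 * (t * δ⁻¹) := by field_simp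
          _ ≤ 1 * (t * δ⁻¹) := by gcongr
          _ = t * δ⁻¹ := one_mul _
      have e3 : 0 < t * δ⁻¹ := by positivity
      linarith
    · rw [sub_zero, abs_of_pos hδ, inv_mul_cancel₀ hδ.ne']
  have h2 : ‖∫ t in δ..(1 / 4), ((t⁻¹ : ℝ) : ℂ) * oddPart P Q lam t‖ ≤ 108 := by
    have hE : ∀ Q' lam', IntervalIntegrable (fun t => ((t⁻¹ : ℝ) : ℂ) *
        Complex.exp (Complex.I * phase P Q' lam' t)) volume δ (1 / 4) := fun Q' lam' => by
      have := continuous_phase P Q' lam'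
      exact intervalIntegrable_inv_mul_of_pos (by fun_prop) hδ (by norm_num)
    have heq : ∀ t, ((t⁻¹ : ℝ) : ℂ) * oddPart P Q lam t = (2 * Complex.I)⁻¹ *
        (((t⁻¹ : ℝ) : ℂ) * Complex.exp (Complex.I * phase P Q lam t) -
          ((t⁻¹ : ℝ) : ℂ) * Complex.exp (Complex.I * phase P (-Q) (-lam) t)) := fun t => by
      rw [oddPart_eq]; ring
    simp only [heq]
    rw [intervalIntegral.integral_const_mul, intervalIntegral.integral_sub (hE _ _) (hE _ _),
      norm_mul]
    have e1 := htail Q lam rfl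
    have e2 := htail (-Q) (-lam) (abs_neg _)
    have e3 : ‖(2 * Complex.I)⁻¹‖ = 1 / 2 := by simp
    rw [e3]
    have := norm_sub_le
      (∫ t in δ..(1 / 4), ((t⁻¹ : ℝ) : ℂ) * Complex.exp (Complex.I * phase P Q lam t))
      (∫ t in δ..(1 / 4), ((t⁻¹ : ℝ) : ℂ) * Complex.exp (Complex.I * phase P (-Q) (-lam) t))
    linarith
  have h3 : ‖∫ t in (1 / 4)..Real.pi, ((t⁻¹ : ℝ) : ℂ) * oddPart P Q lam t‖ ≤ 20 := by
    refine (intervalIntegral.norm_integral_le_of_norm_le_const (C := 4) fun t ht => ?_).trans ?_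
    · rw [uIoc_of_le (by linarith)] at ht
      have ht0 : 0 < t := lt_trans (by norm_num) ht.1
      rw [norm_mul, Complex.norm_real, Real.norm_of_nonneg (by positivity), inv_mul_le_iff₀ ht0]
      linarith [norm_oddPart_le P Q lam t, ht.1]
    · rw [abs_of_pos (by linarith)]
      linarith [Real.pi_lt_four]
  exact (norm_add₃_le).trans (by linarith)

/-- Jordan's inequality gives sin x ≥ x/2. For x ≤ 1 the numerator x - sin x ≤ x³/4 is small against
x sin x; for x ≥ 1 already 1/sin x ≤ 2. -/
theorem abs_inv_sin_sub_inv_le {x : ℝ} (hx : 0 < x) (hx2 : x ≤ Real.pi / 2) :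
    |(Real.sin x)⁻¹ - x⁻¹| ≤ 2 := by
  have h1 := Real.mul_le_sin hx.le hx2
  have hpi := Real.pi_pos
  have hsin : 0 < Real.sin x := lt_of_lt_of_le (by positivity) h1
  have h2 : x⁻¹ ≤ (Real.sin x)⁻¹ := inv_anti₀ hsin (Real.sin_lt hx).le
  rw [abs_of_nonneg (by linarith)]
  have hhalf : x / 2 ≤ Real.sin x := by
    refine le_trans ?_ h1
    have : 1 / 2 ≤ 2 / Real.pi := by
      rw [div_le_div_iff₀ two_pos hpi]; linarith [Real.pi_lt_four]
    nlinarith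
  rcases le_total x 1 with h | h
  · have h3 := Real.sin_gt_sub_cube hx
    rw [inv_sub_inv hsin.ne' hx.ne', div_le_iff₀ (by positivity)]
    nlinarith [mul_le_mul_of_nonneg_right hhalf hx.le, sq_nonneg x, pow_pos hx 3, pow_pos hx 2]
  · have : (Real.sin x)⁻¹ ≤ (1 / 2)⁻¹ := inv_anti₀ (by norm_num) (by linarith)
    have : 0 < x⁻¹ := by positivity
    linarith [show ((1 : ℝ) / 2)⁻¹ = 2 by norm_num]

theorem intervalIntegrable_inv_sin_mul_oddPart (P Q lam : ℝ) : IntervalIntegrable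
    (fun t => (((Real.sin (t / 2))⁻¹ : ℝ) : ℂ) * oddPart P Q lam t) volume 0 Real.pi := by
  have hc := continuous_oddPart P Q lam
  have hm : Measurable fun t => (((Real.sin (t / 2))⁻¹ : ℝ) : ℂ) * oddPart P Q lam t :=
    (Complex.measurable_ofReal.comp (Continuous.measurable (by fun_prop)).inv).mul hc.measurable
  refine intervalIntegrable_of_norm_le hm Real.pi_pos.le (C := Real.pi * (|lam| + |Q|))
    fun t ht => ?_
  have ht0 := ht.1
  have h1 := Real.mul_le_sin (half_pos ht0).le (by linarith [ht.2] : t / 2 ≤ Real.pi / 2)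
  have h2 : 2 / Real.pi * (t / 2) = t / Real.pi := by ring
  rw [h2] at h1
  have hpi := Real.pi_pos
  have hsin : 0 < Real.sin (t / 2) := lt_of_lt_of_le (by positivity) h1
  rw [norm_mul, Complex.norm_real, Real.norm_of_nonneg (by positivity), inv_mul_le_iff₀ hsin]
  calc ‖oddPart P Q lam t‖ ≤ (|lam| + |Q|) * t := norm_oddPart_le_mul P Q lam ht0
    _ = t / Real.pi * (Real.pi * (|lam| + |Q|)) := by field_simp
    _ ≤ _ := by gcongr

theorem norm_integral_inv_sin_mul_oddPart_le (P Q lam : ℝ) :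
    ‖∫ t in (0 : ℝ)..Real.pi, (((Real.sin (t / 2))⁻¹ : ℝ) : ℂ) * oddPart P Q lam t‖ ≤ 272 := by
  have hi := intervalIntegrable_inv_sin_mul_oddPart P Q lam
  have hc := continuous_oddPart P Q lam
  have hm : Measurable fun t => ((t⁻¹ : ℝ) : ℂ) * oddPart P Q lam t :=
    (Complex.measurable_ofReal.comp measurable_inv).mul hc.measurable
  have hi2 : IntervalIntegrable (fun t => ((t⁻¹ : ℝ) : ℂ) * oddPart P Q lam t) volume 0 Real.pi :=
    intervalIntegrable_of_norm_le hm Real.pi_pos.le (C := |lam| + |Q|) fun t ht => by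
      rw [norm_mul, Complex.norm_real, Real.norm_of_nonneg (inv_nonneg.2 ht.1.le),
        inv_mul_le_iff₀ ht.1, mul_comm]
      exact norm_oddPart_le_mul P Q lam ht.1
  have hdec : ∫ t in (0 : ℝ)..Real.pi, (((Real.sin (t / 2))⁻¹ : ℝ) : ℂ) * oddPart P Q lam t =
      (∫ t in (0 : ℝ)..Real.pi, ((((Real.sin (t / 2))⁻¹ : ℝ) : ℂ) * oddPart P Q lam t -
        2 * (((t⁻¹ : ℝ) : ℂ) * oddPart P Q lam t))) +
      2 * ∫ t in (0 : ℝ)..Real.pi, ((t⁻¹ : ℝ) : ℂ) * oddPart P Q lam t := by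
    rw [intervalIntegral.integral_sub hi (hi2.const_mul 2), intervalIntegral.integral_const_mul]
    ring
  rw [hdec]
  refine (norm_add_le _ _).trans ?_
  have h1 := norm_integral_inv_mul_oddPart_le P Q lam
  rw [norm_mul, Complex.norm_ofNat]
  refine (add_le_add (b := 8) ?_ (mul_le_mul_of_nonneg_left h1 two_pos.le)).trans (by norm_num)
  refine (intervalIntegral.norm_integral_le_of_norm_le_const (C := 2) fun t ht => ?_).trans ?_
  · rw [uIoc_of_le Real.pi_pos.le] at ht
    have h2 := abs_inv_sin_sub_inv_le (half_pos ht.1) (by linarith [ht.2])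
    rw [show (((Real.sin (t / 2))⁻¹ : ℝ) : ℂ) * oddPart P Q lam t -
        2 * (((t⁻¹ : ℝ) : ℂ) * oddPart P Q lam t) =
        (((Real.sin (t / 2))⁻¹ - (t / 2)⁻¹ : ℝ) : ℂ) * oddPart P Q lam t by
      push_cast; rw [inv_div]; ring, norm_mul, Complex.norm_real]
    calc _ ≤ (2 : ℝ) * 1 := mul_le_mul h2 (norm_oddPart_le _ _ _ _) (norm_nonneg _) two_pos.le
      _ = 2 := mul_one 2
  · rw [sub_zero, abs_of_pos Real.pi_pos]
    linarith [Real.pi_lt_four]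

end Oscillatory

/-! ### Partial Fourier sums of plane waves on circles -/

section DirichletKernel

open Set

theorem cexp_phase_mul (P Q lam t : ℝ) :
    Complex.exp (Complex.I * phase P Q 0 t) * Complex.exp (Complex.I * (lam * t : ℝ)) =
      Complex.exp (Complex.I * phase P Q lam t) := by
  rw [← Complex.exp_add, phase, phase]; congr 1; push_cast; ring

theorem phase_neg (P Q lam t : ℝ) : phase P Q lam (-t) = phase P (-Q) (-lam) t := by
  simp [phase]

/-- The telescoping behind the Dirichlet kernel, for a block of frequencies that need not be
symmetric. Hence two unrelated end frequencies survive. -/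
theorem two_I_sin_mul_sum (a : ℝ) (n : ℕ) (t : ℝ) :
    2 * Complex.I * (Real.sin (t / 2) : ℂ) *
        ∑ k ∈ Finset.range n, Complex.exp (Complex.I * (-(a + k) * t : ℝ)) =
      Complex.exp (Complex.I * ((1 / 2 - a) * t : ℝ)) -
        Complex.exp (Complex.I * ((1 / 2 - (a + n)) * t : ℝ)) := by
  have h0 : Complex.exp (Complex.I * ((1 / 2 - a) * t : ℝ)) =
      Complex.exp (Complex.I * ((1 / 2 - (a + (0 : ℕ))) * t : ℝ)) := by simp
  rw [h0, ← Finset.sum_range_sub'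
    (fun k : ℕ => Complex.exp (Complex.I * ((1 / 2 - (a + k)) * t : ℝ))), Finset.mul_sum]
  refine Finset.sum_congr rfl fun k _ => ?_
  have h1 : Complex.exp (Complex.I * ((1 / 2 - (a + k)) * t : ℝ)) =
      Complex.exp (Complex.I * (-(a + k) * t : ℝ)) * Complex.exp ((t / 2 : ℝ) * Complex.I) := by
    rw [← Complex.exp_add]; congr 1; push_cast; ring
  have h2 : Complex.exp (Complex.I * ((1 / 2 - (a + (k + 1 : ℕ))) * t : ℝ)) =
      Complex.exp (Complex.I * (-(a + k) * t : ℝ)) * Complex.exp (-(t / 2 : ℝ) * Complex.I) := by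
    rw [← Complex.exp_add]; congr 1; push_cast; ring
  rw [h1, h2, Complex.ofReal_sin, Complex.sin]
  linear_combination (Complex.exp (-(t / 2 : ℝ) * Complex.I) -
    Complex.exp ((t / 2 : ℝ) * Complex.I)) * Complex.exp (Complex.I * (-(a + k) * t : ℝ)) *
    Complex.I_sq

theorem norm_integral_phase_mul_sum_le (P Q a : ℝ) (n : ℕ) :
    ‖∫ t in (-Real.pi)..Real.pi, Complex.exp (Complex.I * phase P Q 0 t) *
      ∑ k ∈ Finset.range n, Complex.exp (Complex.I * (-(a + k) * t : ℝ))‖ ≤ 544 := by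
  set F : ℝ → ℂ := fun t => Complex.exp (Complex.I * phase P Q 0 t) *
      ∑ k ∈ Finset.range n, Complex.exp (Complex.I * (-(a + k) * t : ℝ))
  have hF : Continuous F := by
    have := continuous_phase P Q 0
    fun_prop
  -- Each end frequency alone has a non-integrable singularity 1/sin(t/2) at 0. Adding the values at
  -- t and -t leaves only odd parts, which vanish at 0, so the two frequencies can then be estimated
  -- separately.
  have hfold : ∫ t in (-Real.pi)..Real.pi, F t = ∫ t in (0 : ℝ)..Real.pi, (F t + F (-t)) := by
    have hF' : Continuous fun t => F (-t) := hF.comp continuous_neg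
    rw [intervalIntegral.integral_add (hF.intervalIntegrable _ _)
      (hF'.intervalIntegrable _ _), intervalIntegral.integral_comp_neg,
      neg_zero, add_comm, intervalIntegral.integral_add_adjacent_intervals
      (hF.intervalIntegrable _ _) (hF.intervalIntegrable _ _)]
  have hpt : ∀ t ∈ Ioc 0 Real.pi, F t + F (-t) =
      (((Real.sin (t / 2))⁻¹ : ℝ) : ℂ) * oddPart P Q (1 / 2 - a) t -
      (((Real.sin (t / 2))⁻¹ : ℝ) : ℂ) * oddPart P Q (1 / 2 - (a + n)) t := fun t ht => by
    have hsin : 0 < Real.sin (t / 2) :=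
      Real.sin_pos_of_pos_of_lt_pi (half_pos ht.1) (by linarith [ht.2, ht.1])
    have hs : (Real.sin (t / 2) : ℂ) ≠ 0 := by exact_mod_cast hsin.ne'
    have h1 := two_I_sin_mul_sum a n t
    have h2 := two_I_sin_mul_sum a n (-t)
    rw [neg_div, Real.sin_neg] at h2
    have hD : ∀ t', F t' = Complex.exp (Complex.I * phase P Q 0 t') *
      ∑ k ∈ Finset.range n, Complex.exp (Complex.I * (-(a + k) * t' : ℝ)) := fun _ => rfl
    have h3 : 2 * Complex.I * (Real.sin (t / 2) : ℂ) * F t =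
        Complex.exp (Complex.I * phase P Q (1 / 2 - a) t) -
          Complex.exp (Complex.I * phase P Q (1 / 2 - (a + n)) t) := by
      rw [← cexp_phase_mul P Q (1 / 2 - a), ← cexp_phase_mul P Q (1 / 2 - (a + n)), ← mul_sub,
        ← h1, hD]
      ring
    have h4 : 2 * Complex.I * (Real.sin (t / 2) : ℂ) * F (-t) =
        Complex.exp (Complex.I * phase P (-Q) (-(1 / 2 - (a + n))) t) -
        Complex.exp (Complex.I * phase P (-Q) (-(1 / 2 - a)) t) := by
      rw [← phase_neg, ← phase_neg, ← cexp_phase_mul P Q (1 / 2 - a),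
        ← cexp_phase_mul P Q (1 / 2 - (a + n)), ← mul_sub, ← neg_sub, ← h2, hD]
      push_cast
      ring
    have hne : 2 * Complex.I * (Real.sin (t / 2) : ℂ) ≠ 0 :=
      mul_ne_zero (mul_ne_zero two_ne_zero Complex.I_ne_zero) hs
    rw [← mul_right_inj' hne, mul_add, h3, h4, oddPart_eq, oddPart_eq, Complex.ofReal_inv]
    field_simp
    ring
  rw [hfold, intervalIntegral.integral_congr_ae (g := fun t =>
      (((Real.sin (t / 2))⁻¹ : ℝ) : ℂ) * oddPart P Q (1 / 2 - a) t -
      (((Real.sin (t / 2))⁻¹ : ℝ) : ℂ) * oddPart P Q (1 / 2 - (a + n)) t)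
      (Filter.Eventually.of_forall fun t ht => hpt t (by rwa [uIoc_of_le Real.pi_pos.le] at ht)),
    intervalIntegral.integral_sub (intervalIntegrable_inv_sin_mul_oddPart _ _ _)
      (intervalIntegrable_inv_sin_mul_oddPart _ _ _)]
  refine (norm_sub_le _ _).trans ?_
  have h1 := norm_integral_inv_sin_mul_oddPart_le P Q (1 / 2 - a)
  have h2 := norm_integral_inv_sin_mul_oddPart_le P Q (1 / 2 - (a + n))
  linarith

end DirichletKernel

/-! ### Plane waves on the circle and their Fourier coefficients. -/

section PlaneWave

open Set

theorem inner_unitVec_coe (t : ℝ) (x : ℂ) :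
    inner ℝ (unitVec (t : Angle)) x = x.re * Real.cos t + x.im * Real.sin t := by
  rw [unitVec_coe, Complex.inner, mul_comm Complex.I, Complex.exp_mul_I, ← Complex.ofReal_cos,
    ← Complex.ofReal_sin]
  simp [-Complex.ofReal_cos, -Complex.ofReal_sin]

theorem inner_unitVec_mul_I_coe (t : ℝ) (x : ℂ) :
    inner ℝ (unitVec (t : Angle) * Complex.I) x = -(x.re * Real.sin t) + x.im * Real.cos t := by
  rw [unitVec_coe, Complex.inner, mul_comm Complex.I, Complex.exp_mul_I, ← Complex.ofReal_cos,
    ← Complex.ofReal_sin]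
  simp [-Complex.ofReal_cos, -Complex.ofReal_sin]
  ring

theorem inner_unitVec_add (α β : Angle) (x : ℂ) :
    inner ℝ (unitVec (α + β)) x = inner ℝ (unitVec β) ((starRingEnd ℂ) (unitVec α) * x) := by
  rw [unitVec_add, Complex.inner, Complex.inner, map_mul]
  congr 1
  ring

/-- The plane wave `β ↦ e^{ip⟨u_β, x⟩}` on the circle. -/
def wave (p : ℝ) (x : ℂ) : C(Angle, ℂ) where
  toFun β := Complex.exp (Complex.I * (p * inner ℝ (unitVec β) x : ℝ))
  continuous_toFun := by
    have := continuous_unitVec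
    fun_prop

theorem wave_apply (p : ℝ) (x : ℂ) (β : Angle) :
    wave p x β = Complex.exp (Complex.I * (p * inner ℝ (unitVec β) x : ℝ)) := rfl

theorem norm_wave (p : ℝ) (x : ℂ) (β : Angle) : ‖wave p x β‖ = 1 :=
  norm_cexp_I_mul_ofReal _

theorem wave_coe (p : ℝ) (x : ℂ) (t : ℝ) :
    wave p x (t : Angle) = Complex.exp (Complex.I * phase (p * x.re) (p * x.im) 0 t) := by
  rw [wave_apply, inner_unitVec_coe, phase]; congr 3; ring

theorem wave_add (p : ℝ) (x : ℂ) (α β : Angle) :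
    wave p x (α + β) = wave p ((starRingEnd ℂ) (unitVec α) * x) β := by
  rw [wave_apply, wave_apply, inner_unitVec_add]

/-- The derivative of the plane wave `wave p x` with respect to the angle. -/
def waveDeriv (p : ℝ) (x : ℂ) : C(Angle, ℂ) where
  toFun β := wave p x β * (Complex.I * (p * inner ℝ (unitVec β * Complex.I) x : ℝ))
  continuous_toFun := by
    have := continuous_unitVec
    fun_prop

theorem hasDerivAt_wave (p : ℝ) (x : ℂ) (t : ℝ) :
    HasDerivAt (fun t : ℝ => wave p x (t : Angle)) (waveDeriv p x (t : Angle)) t := by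
  have h := (((hasDerivAt_phase (p * x.re) (p * x.im) 0 t).ofReal_comp).const_mul
    Complex.I).cexp
  simp only [wave_coe]
  convert! h using 1
  change wave p x t * _ = _
  rw [wave_coe, inner_unitVec_mul_I_coe]
  congr 3
  ring

theorem fourierCoeff_of_hasDerivAt {F F' : C(Angle, ℂ)}
    (h : ∀ t : ℝ, HasDerivAt (fun t : ℝ => F (t : Angle)) (F' (t : Angle)) t) {n : ℤ}
    (hn : n ≠ 0) : fourierCoeff F n = (Complex.I * n)⁻¹ * fourierCoeff F' n := by
  have hpi := Real.two_pi_pos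
  have hc : ∀ G : C(Angle, ℂ), fourierCoeff G n =
      fourierCoeffOn hpi (fun t : ℝ => G (t : Angle)) n := fun G => by
    rw [fourierCoeffOn_eq_integral, fourierCoeff_eq_intervalIntegral _ _ 0]
    simp
  have hcont : Continuous fun t : ℝ => F' (t : Angle) :=
    F'.continuous.comp (AddCircle.continuous_mk' _)
  rw [hc F, hc F', fourierCoeffOn_of_hasDerivAt hpi hn (fun t _ => h t)
    (hcont.intervalIntegrable _ _)]
  have h0 : ((2 * Real.pi : ℝ) : Angle) = ((0 : ℝ) : Angle) := by
    rw [AddCircle.coe_period]; rfl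
  have hn' : (n : ℂ) ≠ 0 := by exact_mod_cast hn
  have hpi' : (Real.pi : ℂ) ≠ 0 := by exact_mod_cast Real.pi_ne_zero
  rw [h0]
  simp only [sub_self, mul_zero, zero_sub]
  push_cast
  rw [sub_zero]
  field_simp

/-- For n ≠ 0 the coefficient is |F̂'(n)|/|n| ≤ |F̂'(n)|² + 1/n² in absolute value, and the right
side is summable by Parseval for F'. -/
theorem summable_fourierCoeff_of_hasDerivAt {F F' : C(Angle, ℂ)}
    (h : ∀ t : ℝ, HasDerivAt (fun t : ℝ => F (t : Angle)) (F' (t : Angle)) t) :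
    Summable (fourierCoeff F) := by
  have h1 : Summable fun n : ℤ => ‖fourierCoeff F' n‖ ^ 2 := by
    have := (hasSum_sq_fourierCoeff (ContinuousMap.toLp 2 AddCircle.haarAddCircle ℂ F')).summable
    simpa only [fourierCoeff_toLp] using this
  have h2 : Summable fun n : ℤ => 1 / (n : ℝ) ^ 2 := by
    simpa using Real.summable_one_div_int_pow.2 (by norm_num : 1 < 2)
  have h3 : Summable fun n : ℤ => ‖fourierCoeff F' n‖ ^ 2 + 1 / (n : ℝ) ^ 2 := h1.add h2
  refine h3.of_norm_bounded_eventually ?_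
  refine (Set.finite_singleton (0 : ℤ)).subset fun n hn => ?_
  by_contra h0
  apply hn
  have h0' : n ≠ 0 := h0
  change ‖fourierCoeff F n‖ ≤ _
  rw [fourierCoeff_of_hasDerivAt h h0', norm_mul, norm_inv, norm_mul, Complex.norm_I, one_mul,
    Complex.norm_intCast, one_div, ← sq_abs (n : ℝ), ← inv_pow]
  nlinarith [sq_nonneg (‖fourierCoeff F' n‖ - |(n : ℝ)|⁻¹), sq_nonneg ‖fourierCoeff F' n‖,
    sq_nonneg |(n : ℝ)|⁻¹]

theorem hasSum_wave (p : ℝ) (x : ℂ) (θ : Angle) :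
    HasSum (fun j : ℤ => fourierCoeff (wave p x) j * fourier j θ) (wave p x θ) :=
  has_pointwise_sum_fourier_series_of_summable
    (summable_fourierCoeff_of_hasDerivAt (hasDerivAt_wave p x)) θ

/-- Translating the angle amounts to rotating `x`. So a bound at angle 0 that is uniform in `x`
holds at every angle. -/
theorem fourierCoeff_wave_mul_fourier (p : ℝ) (x : ℂ) (j : ℤ) (θ : Angle) :
    fourierCoeff (wave p x) j * fourier j θ =
      fourierCoeff (wave p ((starRingEnd ℂ) (unitVec θ) * x)) j := by
  have h : fourierCoeff (wave p x) j = ∫ β : Angle, fourier (-j) (θ + β) • wave p x (θ + β)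
      ∂AddCircle.haarAddCircle :=
    (integral_add_left_eq_self (fun β : Angle => fourier (-j) β • wave p x β) θ).symm
  rw [h, mul_comm, ← integral_const_mul]
  refine integral_congr_ae (Filter.Eventually.of_forall fun β => ?_)
  simp only [wave_add, smul_eq_mul, fourier_apply, smul_add, neg_smul, AddCircle.toCircle_add,
    Circle.coe_mul, AddCircle.toCircle_neg, Circle.coe_inv]
  have : (AddCircle.toCircle (j • θ) : ℂ) ≠ 0 := Circle.coe_ne_zero _
  field_simp

/-- The partial Fourier sums of plane waves on circles are bounded, uniformly in the radius. -/
theorem norm_sum_fourierCoeff_wave_le (p : ℝ) (x : ℂ) (θ : Angle) (a b : ℤ) :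
    ‖∑ j ∈ Finset.Icc a b, fourierCoeff (wave p x) j * fourier j θ‖ ≤ 544 := by
  simp only [fourierCoeff_wave_mul_fourier]
  generalize (starRingEnd ℂ) (unitVec θ) * x = y
  have hicc : Finset.Icc a b = (Finset.range (b + 1 - a).toNat).map
    (Nat.castEmbedding.trans <| addLeftEmbedding a) := rfl
  have hint : ∀ j : ℤ, fourierCoeff (wave p y) j = (1 / (2 * Real.pi) : ℝ) *
      ∫ t in (-Real.pi)..Real.pi, Complex.exp (Complex.I * phase (p * y.re) (p * y.im) 0 t) *
        Complex.exp (Complex.I * (-j * t : ℝ)) := fun j => by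
    rw [fourierCoeff_eq_intervalIntegral _ _ (-Real.pi),
      show -Real.pi + 2 * Real.pi = Real.pi by ring, Complex.real_smul]
    congr 1
    refine intervalIntegral.integral_congr fun t _ => ?_
    have hpi' : (Real.pi : ℂ) ≠ 0 := by exact_mod_cast Real.pi_ne_zero
    simp only [smul_eq_mul, wave_coe, fourier_coe_apply]
    rw [mul_comm]
    congr 2
    push_cast
    field_simp
  have hcont : ∀ k : ℕ, Continuous fun t : ℝ =>
      Complex.exp (Complex.I * phase (p * y.re) (p * y.im) 0 t) *
        Complex.exp (Complex.I * (-(a + k) * t : ℝ)) := fun k => by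
    have := continuous_phase (p * y.re) (p * y.im) 0
    fun_prop
  rw [hicc, Finset.sum_map]
  simp only [hint, Function.Embedding.trans_apply, Nat.castEmbedding_apply,
    addLeftEmbedding_apply, Int.cast_add, Int.cast_natCast]
  rw [← Finset.mul_sum, ← intervalIntegral.integral_finsetSum
    fun k _ => (hcont k).intervalIntegrable _ _]
  simp only [← Finset.mul_sum]
  rw [norm_mul, Complex.norm_real, Real.norm_of_nonneg (by positivity)]
  refine (mul_le_mul_of_nonneg_left (norm_integral_phase_mul_sum_le _ _ a _)
    (by positivity)).trans ?_
  rw [div_mul_eq_mul_div, one_mul, div_le_iff₀ Real.two_pi_pos]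
  nlinarith [Real.pi_gt_three]

end PlaneWave

/-! ### The matrix elements of the Fourier transform -/

section MatrixElements

theorem unitVec_neg (θ : Angle) : unitVec (-θ) = (starRingEnd ℂ) (unitVec θ) := by
  rw [unitVec, unitVec, ← fourier_neg]
  simp

/-- Jointly continuous version of `(x, R_θ) ↦ U_p((x, R_θ)⁻¹) e_n`. -/
def repWave (p : ℝ) (n : ℤ) : C(ℂ × Angle, C(Angle, ℂ)) :=
  ContinuousMap.curry
    { toFun := fun q => wave p q.1.1 (q.2 + q.1.2) * fourier n (q.2 + q.1.2)
      continuous_toFun := by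
        have := continuous_unitVec
        simp only [wave_apply]
        refine Continuous.mul (by fun_prop) ((fourier n).continuous.comp (by fun_prop)) }

theorem repWave_apply (p : ℝ) (n : ℤ) (q : ℂ × Angle) (α : Angle) :
    repWave p n q α = wave p q.1 (α + q.2) * fourier n (α + q.2) := rfl

/-- Since ⟨u_α, R_θᵀ x⟩ = ⟨u_{α+θ}, x⟩, the operator U_p(g⁻¹) multiplies by a plane wave and then
shifts by θ. The continuous representative makes the orbit strongly measurable and its coefficients
computable. -/
theorem rep_inv_basisFun (p : ℝ) (g : SE2) (n : ℤ) : rep p g⁻¹ (basisFun n) =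
    ContinuousMap.toLp 2 AddCircle.haarAddCircle ℂ (repWave p n (g.trans, g.rot)) := by
  apply Lp.ext
  have h1 := (measurePreserving_add_right (AddCircle.haarAddCircle (T := 2 * Real.pi))
    g.rot).quasiMeasurePreserving.ae_eq_comp (coeFn_fourierLp (T := 2 * Real.pi) 2 n)
  filter_upwards [(memLp_rep p g⁻¹ (basisFun n)).coeFn_toLp, ContinuousMap.coeFn_toLp (𝕜 := ℂ)
    (p := 2) AddCircle.haarAddCircle (repWave p n (g.trans, g.rot)), h1] with α e1 e2 e3
  rw [rep, e1, e2, repWave_apply, SE2.inv_rot, sub_neg_eq_add, SE2.inv_trans, wave_apply]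
  simp only [Function.comp_apply] at e3
  rw [basisFun, e3, add_comm α, inner_unitVec_add, inner_neg_right, unitVec_neg]
  congr 2
  push_cast
  ring

theorem inner_basisFun_toLp (m : ℤ) (F : C(Angle, ℂ)) :
    inner ℂ (basisFun m) (ContinuousMap.toLp 2 AddCircle.haarAddCircle ℂ F) =
      fourierCoeff F m := by
  rw [basisFun, fourierLp, ContinuousMap.inner_toLp]
  refine integral_congr_ae (Filter.Eventually.of_forall fun α => ?_)
  simp only [fourier_neg, smul_eq_mul, mul_comm]

/-- The shift by θ produces e^{imθ}, and the factor e_n moves the index from m to m - n. -/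
theorem fourierCoeff_repWave (p : ℝ) (n m : ℤ) (x : ℂ) (θ : Angle) :
    fourierCoeff (repWave p n (x, θ)) m = fourier m θ * fourierCoeff (wave p x) (m - n) := by
  rw [fourierCoeff, ← integral_sub_right_eq_self _ θ, fourierCoeff, ← integral_const_mul]
  refine integral_congr_ae (Filter.Eventually.of_forall fun β => ?_)
  simp only [repWave_apply, sub_add_cancel, smul_eq_mul, neg_sub]
  rw [sub_eq_add_neg n m, fourier_add (m := n) (n := -m)]
  have h : fourier (-m) (β - θ) = fourier (-m) β * fourier m θ := by
    simp only [fourier_apply, sub_eq_add_neg, smul_add, AddCircle.toCircle_add, Circle.coe_mul,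
      neg_smul, smul_neg, neg_neg]
  rw [h]
  ring

theorem stronglyMeasurable_comp_pair {E : Type*} [TopologicalSpace E]
    [TopologicalSpace.PseudoMetrizableSpace E] {G : ℂ × Angle → E} (hG : Continuous G) :
    StronglyMeasurable fun g : SE2 => G (g.trans, g.rot) :=
  hG.stronglyMeasurable.comp_measurable (g := SE2.measEquivProd) SE2.measEquivProd.measurable

theorem integrable_smul_rep {c : ℝ} {f : SE2 → ℂ} (hf : Integrable f (haar c)) (p : ℝ) (n : ℤ) :
    Integrable (fun g => f g • rep p g⁻¹ (basisFun n)) (haar c) := by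
  simp only [rep_inv_basisFun]
  have hc : Continuous fun q : ℂ × Angle =>
      ContinuousMap.toLp 2 AddCircle.haarAddCircle ℂ (repWave p n q) :=
    (ContinuousMap.toLp (E := ℂ) 2 AddCircle.haarAddCircle ℂ).continuous.comp
      (repWave p n).continuous
  refine hf.smul_bdd ‖ContinuousMap.toLp (E := ℂ) 2 (AddCircle.haarAddCircle (T := 2 * Real.pi)) ℂ‖
    (stronglyMeasurable_comp_pair hc).aestronglyMeasurable (Filter.Eventually.of_forall fun g => ?_)
  refine (ContinuousLinearMap.le_opNorm _ _).trans (mul_le_of_le_one_right (norm_nonneg _) ?_)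
  refine (ContinuousMap.norm_le _ zero_le_one).2 fun α => ?_
  rw [repWave_apply, norm_mul, norm_wave, one_mul]
  exact (ContinuousMap.norm_coe_le_norm _ _).trans_eq (fourier_norm n)

theorem fourierEntry_eq_integral {c : ℝ} {f : SE2 → ℂ} (hf : Integrable f (haar c)) (p : ℝ)
    (n m : ℤ) : fourierEntry c f p n m =
      ∫ g, f g * (fourier m g.rot * fourierCoeff (wave p g.trans) (m - n)) ∂(haar c) := by
  rw [fourierEntry, fourierOp, ← integral_inner (integrable_smul_rep hf p n)]
  refine integral_congr_ae (Filter.Eventually.of_forall fun g => ?_)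
  simp only [inner_smul_right, rep_inv_basisFun, inner_basisFun_toLp, fourierCoeff_repWave]

theorem continuous_fourierCoeff_wave (p : ℝ) (j : ℤ) :
    Continuous fun x : ℂ => fourierCoeff (wave p x) j := by
  have h : ∀ x : ℂ, fourierCoeff (wave p x) j = fourierCoeff (repWave p 0 (x, 0)) j := fun x => by
    rw [fourierCoeff_repWave, sub_zero]; simp
  simp only [h, ← inner_basisFun_toLp]
  refine Continuous.inner continuous_const ((ContinuousLinearMap.continuous _).comp
    ((repWave p 0).continuous.comp (by fun_prop)))

/-- Dominated convergence along this filter requires it to be countably generated. -/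
instance : (SummationFilter.conditional ℤ).filter.IsCountablyGenerated := by
  rw [SummationFilter.conditional_filter]; infer_instance

/-- The series `∑ₙ e^{-inθ} f̂(2πρ)_{nm}` converges, for every integrable `f`. -/
theorem hasSum_seriesTerm {c : ℝ} {f : SE2 → ℂ} (hf : Integrable f (haar c)) (ρ θ : ℝ) (m : ℤ) :
    HasSum (seriesTerm c f ρ θ m) (∫ g, f g * (Complex.exp (-Complex.I * m * θ) * fourier m g.rot *
      wave (2 * Real.pi * ρ) g.trans (θ : Angle)) ∂(haar c)) (SummationFilter.conditional ℤ) := by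
  set p := 2 * Real.pi * ρ
  set T : ℤ → SE2 → ℂ := fun n g => Complex.exp (-Complex.I * m * θ) * fourier m g.rot *
    (fourierCoeff (wave p g.trans) (m - n) * fourier (m - n) (θ : Angle)) with hT
  have hTm : ∀ n, StronglyMeasurable (T n) := fun n => by
    have hc : Continuous fun q : ℂ × Angle => Complex.exp (-Complex.I * m * θ) * fourier m q.2 *
        (fourierCoeff (wave p q.1) (m - n) * fourier (m - n) (θ : Angle)) := by
      have := continuous_fourierCoeff_wave p (m - n)
      refine Continuous.mul (continuous_const.mul ((fourier m).continuous.comp continuous_snd))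
        ((this.comp continuous_fst).mul continuous_const)
    exact stronglyMeasurable_comp_pair hc
  have hphase : ‖Complex.exp (-Complex.I * m * θ)‖ = 1 := by
    rw [show -Complex.I * m * θ = Complex.I * (-(m * θ) : ℝ) by push_cast; ring]
    exact norm_cexp_I_mul_ofReal _
  have hfour : ∀ (j : ℤ) (α : Angle), ‖fourier j α‖ ≤ 1 := fun j α =>
    (ContinuousMap.norm_coe_le_norm _ _).trans_eq (fourier_norm j)
  have hsum_le : ∀ (a b : ℤ) (g : SE2), ‖∑ n ∈ Finset.Icc a b, T n g‖ ≤ 544 := fun a b g => by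
    -- The substitution j = m - n maps intervals to intervals that are off centre, so the uniform
    -- bound is needed for arbitrary intervals.
    have hre : ∑ n ∈ Finset.Icc a b,
        fourierCoeff (wave p g.trans) (m - n) * fourier (m - n) (θ : Angle) =
        ∑ j ∈ Finset.Icc (m - b) (m - a),
          fourierCoeff (wave p g.trans) j * fourier j (θ : Angle) := by
      refine Finset.sum_nbij' (fun n => m - n) (fun j => m - j) ?_ ?_ ?_ ?_ ?_ <;>
        intro n hn <;> simp only [Finset.mem_Icc] at * <;> omega
    rw [hT, ← Finset.mul_sum, hre, norm_mul, norm_mul, hphase, one_mul]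
    exact (mul_le_of_le_one_left (norm_nonneg _) (hfour _ _)).trans
      (norm_sum_fourierCoeff_wave_le p g.trans θ _ _)
  have hTlim : ∀ g, HasSum (fun n => T n g) (Complex.exp (-Complex.I * m * θ) * fourier m g.rot *
      wave p g.trans (θ : Angle)) (SummationFilter.conditional ℤ) := fun g => by
    have h := ((Equiv.subLeft m).hasSum_iff.2 (hasSum_wave p g.trans (θ : Angle))).mul_left
      (Complex.exp (-Complex.I * m * θ) * fourier m g.rot)
    exact Filter.Tendsto.mono_left h (SummationFilter.conditional ℤ).le_atTop
  have hTbd : ∀ n g, ‖T n g‖ ≤ 544 := fun n g => by simpa using hsum_le n n g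
  have hint : ∀ n, Integrable (fun g => f g * T n g) (haar c) := fun n =>
    hf.mul_bdd (hTm n).aestronglyMeasurable (Filter.Eventually.of_forall (hTbd n))
  have hterm : ∀ n, seriesTerm c f ρ θ m n = ∫ g, f g * T n g ∂(haar c) := fun n => by
    rw [seriesTerm, fourierEntry_eq_integral hf, ← integral_const_mul]
    refine integral_congr_ae (Filter.Eventually.of_forall fun g => ?_)
    have : Complex.exp (-Complex.I * n * θ) =
        Complex.exp (-Complex.I * m * θ) * fourier (m - n) (θ : Angle) := by
      have hpi : (Real.pi : ℂ) ≠ 0 := by exact_mod_cast Real.pi_ne_zero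
      rw [fourier_coe_apply, ← Complex.exp_add]
      congr 1
      push_cast
      field_simp
      ring
    simp only [hT, this]
    ring
  have hfin : ∀ s : Finset ℤ, ∑ n ∈ s, seriesTerm c f ρ θ m n =
      ∫ g, f g * ∑ n ∈ s, T n g ∂(haar c) := fun s => by
    simp only [hterm, Finset.mul_sum]
    rw [integral_finsetSum _ fun n _ => hint n]
  rw [HasSum]
  simp only [hfin]
  refine tendsto_integral_filter_of_dominated_convergence (fun g => ‖f g‖ * 544) ?_ ?_
    (hf.norm.mul_const _) (Filter.Eventually.of_forall fun g => (hTlim g).const_mul _)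
  · exact Filter.Eventually.of_forall fun s => hf.1.mul
      (Finset.stronglyMeasurable_fun_sum s fun n _ => hTm n).aestronglyMeasurable
  · rw [SummationFilter.conditional_filter, Filter.eventually_map]
    refine Filter.Eventually.of_forall fun ab => Filter.Eventually.of_forall fun g => ?_
    rw [norm_mul]
    gcongr
    exact hsum_le _ _ g

end MatrixElements

/-! ### Integration on the coset space -/

section CosetIntegration

/-- The representative of the coset `Γ g` in the fundamental domain. -/
def reduce (g : SE2) : SE2 :=
  ⟨Int.fract g.trans.re + Int.fract g.trans.im * Complex.I, g.rot⟩

theorem measurable_reduce : Measurable reduce := by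
  refine SE2.measEquivProd.symm.measurable.comp
    (g := SE2.measEquivProd.symm) (f := fun g => (reduce g).equivProd) (Measurable.prodMk ?_ ?_)
  · exact (Complex.measurable_ofReal.comp (measurable_fract.comp
      (Complex.measurable_re.comp SE2.measurable_trans))).add ((Complex.measurable_ofReal.comp
      (measurable_fract.comp (Complex.measurable_im.comp SE2.measurable_trans))).mul_const _)
  · exact SE2.measurable_rot

theorem reduce_of_mem {g : SE2} (hg : g ∈ fundDomain) : reduce g = g := by
  ext
  · rw [reduce, Int.fract_eq_self.2 ⟨hg.1.1, hg.1.2⟩, Int.fract_eq_self.2 ⟨hg.2.1, hg.2.2⟩]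
    exact Complex.re_add_im _
  · rfl

theorem reduce_smul (γ : lattice) (g : SE2) : reduce (γ * g) = reduce g := by
  obtain ⟨γ, ⟨k, l, h⟩, h0⟩ := γ
  ext
  · simp [reduce, h, h0, unitVec_zero]
  · simp [reduce, h0]

theorem exists_lattice_mul_eq_reduce (g : SE2) : ∃ γ : lattice, γ * g = reduce g := by
  refine ⟨⟨⟨(-⌊g.trans.re⌋ : ℤ) + (-⌊g.trans.im⌋ : ℤ) * Complex.I, 0⟩, ⟨_, _, rfl⟩, rfl⟩, ?_⟩
  ext
  · apply Complex.ext <;> simp [reduce, unitVec_zero, neg_add_eq_sub]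
  · simp [reduce]

/-- The measurable section of `toCoset` with values in the fundamental domain. -/
def cosetRep : CosetSpace → SE2 :=
  Quotient.lift reduce (by rintro _ b ⟨γ, rfl⟩; exact reduce_smul γ b)

theorem toCoset_lattice_mul (γ : lattice) (g : SE2) : toCoset (γ * g) = toCoset g :=
  Quotient.sound ⟨γ, rfl⟩

theorem toCoset_cosetRep (q : CosetSpace) : toCoset (cosetRep q) = q := by
  induction q using Quotient.inductionOn with
  | h g =>
    obtain ⟨γ, hγ⟩ := exists_lattice_mul_eq_reduce g
    change toCoset (reduce g) = toCoset g
    rw [← hγ, toCoset_lattice_mul]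

theorem measurableSet_fundDomain : MeasurableSet fundDomain :=
  ((Complex.measurable_re.comp SE2.measurable_trans) measurableSet_Ico).inter
    ((Complex.measurable_im.comp SE2.measurable_trans) measurableSet_Ico)

theorem measurePreserving_toCoset (c : ℝ) :
    MeasurePreserving toCoset ((haar c).restrict fundDomain) (cosetMeasure c) :=
  ⟨measurable_toCoset, rfl⟩

theorem measurePreserving_cosetRep (c : ℝ) :
    MeasurePreserving cosetRep (cosetMeasure c) ((haar c).restrict fundDomain) := by
  have hm : Measurable cosetRep := fun s hs => measurable_reduce hs
  refine ⟨hm, ?_⟩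
  rw [cosetMeasure, Measure.map_map hm measurable_toCoset]
  have : cosetRep ∘ toCoset =ᵐ[(haar c).restrict fundDomain] id := by
    filter_upwards [ae_restrict_mem measurableSet_fundDomain] with g hg
    exact reduce_of_mem hg
  rw [Measure.map_congr this, Measure.map_id]

/-- Composition with the measure preserving section `cosetRep` brings measurability from the
fundamental domain down to the quotient. -/
theorem aestronglyMeasurable_cosetMeasure {E : Type*} [TopologicalSpace E] {c : ℝ}
    {F : CosetSpace → E}
    (hF : AEStronglyMeasurable (fun g => F (toCoset g)) ((haar c).restrict fundDomain)) :
    AEStronglyMeasurable F (cosetMeasure c) := by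
  have h := hF.comp_measurePreserving (measurePreserving_cosetRep c)
  have heq : (fun g => F (toCoset g)) ∘ cosetRep = F := by
    funext q
    simp only [Function.comp_apply, toCoset_cosetRep]
  rwa [heq] at h

variable {c : ℝ} {f : SE2 → ℂ}

theorem smulInvariantMeasure_lattice (c : ℝ) : SMulInvariantMeasure lattice SE2 (haar c) :=
  ⟨fun γ _ hs => (measurePreserving_lattice_mul c γ).measure_preimage hs.nullMeasurableSet⟩

theorem measurableConstSMul_lattice : MeasurableConstSMul lattice SE2 :=
  ⟨fun γ => (measurePreserving_lattice_mul 1 γ).measurable⟩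

theorem aestronglyMeasurable_translate (hf : AEStronglyMeasurable f (haar c)) (γ : lattice) :
    AEStronglyMeasurable (fun g => f (γ * g)) ((haar c).restrict fundDomain) :=
  (hf.comp_measurePreserving (measurePreserving_lattice_mul c γ)).restrict

theorem tsum_lintegral_translate (f : SE2 → ℂ) (c : ℝ) :
    ∑' γ : lattice, ∫⁻ g in fundDomain, ‖f (γ * g)‖ₑ ∂(haar c) = ∫⁻ g, ‖f g‖ₑ ∂(haar c) := by
  have := countable_lattice
  have := smulInvariantMeasure_lattice c
  have := measurableConstSMul_lattice
  exact ((isFundamentalDomain_fundDomain c).lintegral_eq_tsum'' fun g => ‖f g‖ₑ).symm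

/-- By Tonelli, the sum of the |f(γg)| has integral ‖f‖₁ over the fundamental domain, hence is
finite almost everywhere. -/
theorem ae_summable_translate (hf : Integrable f (haar c)) :
    ∀ᵐ g ∂(haar c).restrict fundDomain, Summable fun γ : lattice => f (γ * g) := by
  have := countable_lattice
  have h : ∫⁻ g in fundDomain, ∑' γ : lattice, ‖f (γ * g)‖ₑ ∂(haar c) ≠ ∞ := by
    rw [lintegral_tsum fun γ => (aestronglyMeasurable_translate hf.1 γ).enorm,
      tsum_lintegral_translate]
    exact hf.2.ne
  filter_upwards [ae_lt_top' (AEMeasurable.tsum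
    fun γ => (aestronglyMeasurable_translate hf.1 γ).enorm) h] with g hg
  exact .of_enorm hg.ne

theorem aestronglyMeasurable_periodize (hf : Integrable f (haar c)) :
    AEStronglyMeasurable (periodize f) (cosetMeasure c) := by
  have := countable_lattice
  refine aestronglyMeasurable_cosetMeasure ?_
  refine aestronglyMeasurable_of_tendsto_ae (Filter.atTop : Filter (Finset lattice))
    (f := fun s g => ∑ γ ∈ s, f (γ * g)) (fun s => ?_) ?_
  · exact Finset.aestronglyMeasurable_fun_sum s fun γ _ => aestronglyMeasurable_translate hf.1 γ
  · filter_upwards [ae_summable_translate hf] with g hg using hg.hasSum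

theorem norm_periodize_le (f : SE2 → ℂ) (q : CosetSpace) :
    ‖periodize f q‖ ≤ ‖periodize (fun g => ‖f g‖) q‖ := by
  induction q using Quotient.inductionOn with
  | h g =>
    change ‖∑' γ : lattice, f (γ * g)‖ ≤ ‖∑' γ : lattice, ‖f (γ * g)‖‖
    rw [Real.norm_of_nonneg (tsum_nonneg fun _ => norm_nonneg _)]
    by_cases h : Summable fun γ : lattice => ‖f (γ * g)‖
    · exact norm_tsum_le_tsum_norm h
    -- Summability in ℂ is absolute, so here the left side is the default value 0.
    · rw [tsum_eq_zero_of_not_summable fun h' => h h'.norm, norm_zero]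
      exact tsum_nonneg fun _ => norm_nonneg _

theorem memLp_periodize (hf : Integrable f (haar c))
    (hf2 : MemLp (periodize fun g => ‖f g‖) 2 (cosetMeasure c)) :
    MemLp (periodize f) 2 (cosetMeasure c) :=
  hf2.of_le (aestronglyMeasurable_periodize hf) (Filter.Eventually.of_forall (norm_periodize_le f))

/-- Unfolding of an integral against a bounded invariant function. -/
theorem integral_periodize_mul (hf : Integrable f (haar c)) {e : SE2 → ℂ} (he : Measurable e)
    {C : ℝ} (heC : ∀ g, ‖e g‖ ≤ C) (hinv : ∀ (γ : lattice) g, e (γ * g) = e g) :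
    ∫ g in fundDomain, periodize f (toCoset g) * e g ∂(haar c) = ∫ g, f g * e g ∂(haar c) := by
  have := countable_lattice
  have := smulInvariantMeasure_lattice c
  have := measurableConstSMul_lattice
  have hfe : Integrable (fun g => f g * e g) (haar c) :=
    hf.mul_bdd he.aestronglyMeasurable (Filter.Eventually.of_forall heC)
  rw [(isFundamentalDomain_fundDomain c).integral_eq_tsum'' (fun g => f g * e g) hfe]
  change _ = ∑' γ : lattice, ∫ g in fundDomain, f (γ * g) * e (γ * g) ∂(haar c)
  rw [← integral_tsum (fun γ => aestronglyMeasurable_translate hfe.1 γ)]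
  · refine integral_congr_ae (Filter.Eventually.of_forall fun g => ?_)
    simp only [hinv, tsum_mul_right]
    rfl
  · rw [tsum_lintegral_translate fun g => f g * e g]
    exact hfe.2.ne

theorem eLpNorm_periodize_sq (hf : Integrable f (haar c)) :
    eLpNorm (periodize f) 2 (cosetMeasure c) ^ 2 =
      ∫⁻ g in fundDomain, ‖periodize f (toCoset g)‖ₑ ^ 2 ∂(haar c) := by
  rw [← eLpNorm_comp_measurePreserving (aestronglyMeasurable_periodize hf)
    (measurePreserving_toCoset c), eLpNorm_eq_lintegral_rpow_enorm_toReal two_ne_zero (by simp),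
    ← ENNReal.rpow_natCast, ← ENNReal.rpow_mul]
  simp

end CosetIntegration

/-! ### Parseval's identity on the coset space -/

section Parseval

open Set

/-- Parseval with values in `ℝ≥0∞`, where sums can later be regrouped without summability
conditions. -/
theorem tsum_enorm_sq_mFourierCoeff {d : Type*} [Fintype d] {G : UnitAddTorus d → ℂ}
    (hG : MemLp G 2 (Measure.pi fun _ => AddCircle.haarAddCircle)) :
    ∑' n, ‖UnitAddTorus.mFourierCoeff G n‖ₑ ^ 2 =
      ∫⁻ y, ‖G y‖ₑ ^ 2 ∂(Measure.pi fun _ => AddCircle.haarAddCircle) := by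
  have hsum := UnitAddTorus.hasSum_sq_mFourierCoeff (d := d) (hG.toLp G)
  have hco : ∀ n, UnitAddTorus.mFourierCoeff (hG.toLp G) n = UnitAddTorus.mFourierCoeff G n :=
    fun n => integral_congr_ae (by
      filter_upwards [hG.coeFn_toLp] with y hy
      exact congrArg _ hy)
  simp only [hco] at hsum
  have hint : ∫ y, ‖(hG.toLp G) y‖ ^ 2 ∂(Measure.pi fun _ => AddCircle.haarAddCircle) =
      ∫ y, ‖G y‖ ^ 2 ∂(Measure.pi fun _ => AddCircle.haarAddCircle) :=
    integral_congr_ae (by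
      filter_upwards [hG.coeFn_toLp] with y hy
      rw [hy])
  have h2 : Integrable (fun y => ‖G y‖ ^ 2) (Measure.pi fun _ => AddCircle.haarAddCircle) :=
    hG.integrable_norm_pow two_ne_zero
  have h1 : ∀ z : ℂ, ‖z‖ₑ ^ 2 = ENNReal.ofReal (‖z‖ ^ 2) := fun z => by
    rw [ENNReal.ofReal_pow (norm_nonneg _), ofReal_norm]
  simp only [h1]
  rw [← ENNReal.ofReal_tsum_of_nonneg (fun _ => sq_nonneg _) hsum.summable, hsum.tsum_eq,
    ← ofReal_integral_eq_lintegral_ofReal h2 (Filter.Eventually.of_forall fun _ => sq_nonneg _)]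
  exact congrArg _ hint

/-- The section of `ℝ → ℝ / ℤ` with values in `(0, 1]`. -/
def unitRep (y : UnitAddCircle) : ℝ := AddCircle.equivIoc 1 0 y

theorem coe_unitRep (y : UnitAddCircle) : (unitRep y : UnitAddCircle) = y :=
  (AddCircle.equivIoc 1 0).symm_apply_apply y

theorem haarAddCircle_one_eq_volume :
    (AddCircle.haarAddCircle : Measure UnitAddCircle) = volume := by
  rw [AddCircle.volume_eq_smul_haarAddCircle, ENNReal.ofReal_one, one_smul]

theorem measurePreserving_unitRep : MeasurePreserving unitRep
    (AddCircle.haarAddCircle : Measure UnitAddCircle) (volume.restrict (Ico 0 1)) := by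
  -- The representatives lie in (0, 1], whereas the fundamental domain uses [0, 1); the difference
  -- is a null set.
  rw [haarAddCircle_one_eq_volume, Measure.restrict_congr_set Ico_ae_eq_Ioc]
  have h := (measurePreserving_subtype_coe (μa := (volume : Measure ℝ))
    (measurableSet_Ioc (a := (0 : ℝ)) (b := 0 + 1))).comp
    (AddCircle.measurePreserving_equivIoc 1 (a := 0))
  have h01 : Ioc (0 : ℝ) 1 = Ioc 0 (0 + 1) := by rw [zero_add]
  rw [h01]
  exact h

/-- The rescaling of `ℝ / ℤ` to the circle of angles. -/
def toAngle : UnitAddCircle →+ Angle :=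
  (AddCircle.equivAddCircle 1 (2 * Real.pi) one_ne_zero Real.two_pi_pos.ne').toAddMonoidHom

theorem toAngle_coe (t : ℝ) : toAngle (t : UnitAddCircle) = ((t * (2 * Real.pi) : ℝ) : Angle) := by
  change AddCircle.equivAddCircle 1 (2 * Real.pi) one_ne_zero Real.two_pi_pos.ne' _ = _
  rw [AddCircle.equivAddCircle_apply_mk, inv_one, one_mul]

theorem fourier_toAngle (n : ℤ) (y : UnitAddCircle) :
    fourier n (toAngle y) = fourier n y := by
  induction y using QuotientAddGroup.induction_on with
  | H t =>
    have hpi : (Real.pi : ℂ) ≠ 0 := by exact_mod_cast Real.pi_ne_zero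
    change fourier n (toAngle (t : UnitAddCircle)) = fourier n (t : UnitAddCircle)
    rw [toAngle_coe, fourier_coe_apply, fourier_coe_apply]
    congr 1
    push_cast
    field_simp

/-- A continuous surjective homomorphism of compact groups carries the normalized Haar measure to
the normalized Haar measure. -/
theorem measurePreserving_toAngle : MeasurePreserving toAngle
    (AddCircle.haarAddCircle : Measure UnitAddCircle)
    (AddCircle.haarAddCircle : Measure Angle) := by
  refine AddMonoidHom.measurePreserving (f := toAngle) ?_ ?_ ?_
  · exact (AddCircle.homeomorphAddCircle 1 (2 * Real.pi) one_ne_zero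
      Real.two_pi_pos.ne').continuous
  · exact (AddCircle.equivAddCircle 1 (2 * Real.pi) one_ne_zero Real.two_pi_pos.ne').surjective
  · simp

/-- The parametrization of the fundamental domain by the torus `(ℝ / ℤ)³`. -/
def ofTorus (y : UnitAddTorus (Fin 3)) : SE2 :=
  ⟨unitRep (y 0) + unitRep (y 1) * Complex.I, toAngle (y 2)⟩

theorem haar_restrict_fundDomain : (haar (2 * Real.pi)⁻¹).restrict fundDomain =
    Measure.map SE2.measEquivProd.symm (((volume : Measure ℂ).restrict
      {z | z.re ∈ Ico (0 : ℝ) 1 ∧ z.im ∈ Ico (0 : ℝ) 1}).prod AddCircle.haarAddCircle) := by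
  have h1 : (volume : Measure Angle) =
      ENNReal.ofReal (2 * Real.pi) • AddCircle.haarAddCircle :=
    AddCircle.volume_eq_smul_haarAddCircle
  have hpre : SE2.measEquivProd.symm ⁻¹' fundDomain =
      {z : ℂ | z.re ∈ Ico (0 : ℝ) 1 ∧ z.im ∈ Ico (0 : ℝ) 1} ×ˢ univ := by
    ext ⟨z, α⟩
    simp only [mem_preimage, mem_prod, mem_univ, and_true]
    rfl
  rw [haar, h1, Measure.prod_smul_right, Measure.map_smul, smul_smul,
    ← ENNReal.ofReal_mul (by positivity), inv_mul_cancel₀ Real.two_pi_pos.ne', ENNReal.ofReal_one,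
    one_smul, Measure.restrict_map SE2.measEquivProd.symm.measurable measurableSet_fundDomain,
    hpre, Measure.restrict_prod_eq_prod_univ]

theorem measurePreserving_ofTorus : MeasurePreserving ofTorus
    (Measure.pi fun _ => AddCircle.haarAddCircle)
    ((haar (2 * Real.pi)⁻¹).restrict fundDomain) := by
  -- The angle is coordinate 2. It is split off in front of the two planar coordinates, and a swap
  -- at the end puts the plane first.
  have h1 := measurePreserving_piFinSuccAbove
    (fun _ : Fin 3 => (AddCircle.haarAddCircle : Measure UnitAddCircle)) 2
  have h2 := (MeasurePreserving.id (AddCircle.haarAddCircle : Measure UnitAddCircle)).prod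
    (measurePreserving_finTwoArrow (AddCircle.haarAddCircle : Measure UnitAddCircle))
  have h3 := measurePreserving_toAngle.prod
    (measurePreserving_unitRep.prod measurePreserving_unitRep)
  have h4 : MeasurePreserving Complex.measurableEquivRealProd.symm
      ((volume.restrict (Ico (0 : ℝ) 1)).prod (volume.restrict (Ico (0 : ℝ) 1)))
      ((volume : Measure ℂ).restrict {z | z.re ∈ Ico (0 : ℝ) 1 ∧ z.im ∈ Ico (0 : ℝ) 1}) := by
    have := (Complex.volume_preserving_equiv_real_prod.symm).restrict_preimage_emb
      (MeasurableEquiv.measurableEmbedding _)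
      {z : ℂ | z.re ∈ Ico (0 : ℝ) 1 ∧ z.im ∈ Ico (0 : ℝ) 1}
    rwa [show Complex.measurableEquivRealProd.symm ⁻¹'
      {z : ℂ | z.re ∈ Ico (0 : ℝ) 1 ∧ z.im ∈ Ico (0 : ℝ) 1} = Ico 0 1 ×ˢ Ico 0 1 from rfl,
      Measure.volume_eq_prod, ← Measure.prod_restrict] at this
  have h5 := (MeasurePreserving.id (AddCircle.haarAddCircle : Measure Angle)).prod h4
  have h6 := ((Measure.measurePreserving_swap.comp h5).comp h3).comp (h2.comp h1)
  rw [haar_restrict_fundDomain]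
  have h7 := (SE2.measEquivProd.symm.measurable.measurePreserving _).comp h6
  convert! h7 using 1
  funext y
  ext
  · apply Complex.ext
    · change (unitRep (y 0) + unitRep (y 1) * Complex.I : ℂ).re = unitRep (y 0)
      simp
    · change (unitRep (y 0) + unitRep (y 1) * Complex.I : ℂ).im = unitRep (y 1)
      simp
  · rfl

/-- The characters `(x, R_θ) ↦ e^{2πi(k₁x₁ + k₂x₂)} e^{imθ}`, invariant under `ℤ²`. -/
def latticeChar (k₁ k₂ m : ℤ) (g : SE2) : ℂ :=
  fourier k₁ (g.trans.re : UnitAddCircle) * fourier k₂ (g.trans.im : UnitAddCircle) *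
    fourier m g.rot

theorem measurable_latticeChar (k₁ k₂ m : ℤ) : Measurable (latticeChar k₁ k₂ m) := by
  refine ((Measurable.comp (fourier k₁).continuous.measurable ?_).mul
    (Measurable.comp (fourier k₂).continuous.measurable ?_)).mul
    ((fourier m).continuous.measurable.comp SE2.measurable_rot)
  · exact AddCircle.measurable_mk'.comp (Complex.measurable_re.comp SE2.measurable_trans)
  · exact AddCircle.measurable_mk'.comp (Complex.measurable_im.comp SE2.measurable_trans)

theorem norm_latticeChar (k₁ k₂ m : ℤ) (g : SE2) : ‖latticeChar k₁ k₂ m g‖ = 1 := by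
  simp only [latticeChar, fourier_apply, norm_mul, Circle.norm_coe, mul_one]

theorem latticeChar_lattice_mul (k₁ k₂ m : ℤ) (γ : lattice) (g : SE2) :
    latticeChar k₁ k₂ m (γ * g) = latticeChar k₁ k₂ m g := by
  obtain ⟨γ, ⟨k, l, h⟩, h0⟩ := γ
  have hz : ∀ j : ℤ, ((j : ℝ) : UnitAddCircle) = 0 := fun j =>
    (AddCircle.coe_eq_zero_iff 1).2 ⟨j, by simp⟩
  simp [latticeChar, h, h0, unitVec_zero, hz]

theorem latticeChar_ofTorus (n : Fin 3 → ℤ) (y : UnitAddTorus (Fin 3)) :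
    latticeChar (n 0) (n 1) (n 2) (ofTorus y) = UnitAddTorus.mFourier n y := by
  have h1 : (ofTorus y).trans.re = unitRep (y 0) := by simp [ofTorus]
  have h2 : (ofTorus y).trans.im = unitRep (y 1) := by simp [ofTorus]
  rw [latticeChar, h1, h2, coe_unitRep, coe_unitRep]
  change _ * fourier (n 2) (toAngle (y 2)) = ∏ i, fourier (n i) (y i)
  rw [fourier_toAngle, Fin.prod_univ_three]

theorem haar_eq_smul {c : ℝ} :
    haar c = ENNReal.ofReal (2 * Real.pi * c) • haar (2 * Real.pi)⁻¹ := by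
  have h := Real.two_pi_pos
  rw [haar, haar, smul_smul, ← ENNReal.ofReal_mul' (by positivity)]
  congr 2
  field_simp

/-- Parseval's identity for `ℤ² \ SE(2)`, in terms of integrals over SE(2). -/
theorem parseval_periodize {c : ℝ} (hc : 0 < c) {f : SE2 → ℂ} (hf : Integrable f (haar c))
    (hf2 : MemLp (periodize f) 2 (cosetMeasure c)) :
    ENNReal.ofReal (2 * Real.pi * c) * eLpNorm (periodize f) 2 (cosetMeasure c) ^ 2 =
      ∑' n : Fin 3 → ℤ, ‖∫ g, f g * latticeChar (n 0) (n 1) (n 2) g ∂(haar c)‖ₑ ^ 2 := by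
  set K := ENNReal.ofReal (2 * Real.pi * c) with hK
  have hKpos : 0 < 2 * Real.pi * c := by positivity
  have hK0 : K ≠ 0 := by simpa [hK] using hKpos
  have hKt : K ≠ ∞ := ENNReal.ofReal_ne_top
  have hrestr : (haar c).restrict fundDomain =
      K • (haar (2 * Real.pi)⁻¹).restrict fundDomain := by
    rw [haar_eq_smul, Measure.restrict_smul]
  have hF : MemLp (fun g => periodize f (toCoset g)) 2 ((haar c).restrict fundDomain) :=
    hf2.comp_measurePreserving (measurePreserving_toCoset c)
  have hF1 : MemLp (fun g => periodize f (toCoset g)) 2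
      ((haar (2 * Real.pi)⁻¹).restrict fundDomain) := by
    refine hF.of_measure_le_smul (c := K⁻¹) (ENNReal.inv_ne_top.2 hK0) ?_
    rw [hrestr, smul_smul, ENNReal.inv_mul_cancel hK0 hKt, one_smul]
  have hG := hF1.comp_measurePreserving measurePreserving_ofTorus
  -- The index is -n because Fourier coefficients carry the conjugate character. With K = 2πc the
  -- measure `haar c` is K times the normalized one. Each coefficient thus gains K and its square
  -- K²; one of these factors is absorbed into ‖f̃‖², the other is the factor of the theorem.
  have hcoef : ∀ n : Fin 3 → ℤ, ∫ g, f g * latticeChar (n 0) (n 1) (n 2) g ∂(haar c) =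
      ((2 * Real.pi * c : ℝ) : ℂ) * UnitAddTorus.mFourierCoeff
        ((fun g => periodize f (toCoset g)) ∘ ofTorus) (-n) := fun n => by
    rw [← integral_periodize_mul hf (measurable_latticeChar _ _ _)
      (fun g => (norm_latticeChar _ _ _ g).le) (latticeChar_lattice_mul _ _ _), hrestr,
      integral_smul_measure, hK, ENNReal.toReal_ofReal hKpos.le, Complex.real_smul]
    congr 1
    have hAE : AEStronglyMeasurable (fun g => periodize f (toCoset g) *
        latticeChar (n 0) (n 1) (n 2) g) (Measure.map ofTorus
          (Measure.pi fun _ => AddCircle.haarAddCircle)) := by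
      rw [measurePreserving_ofTorus.map_eq]
      exact hF1.1.mul (measurable_latticeChar _ _ _).aestronglyMeasurable
    rw [← measurePreserving_ofTorus.map_eq,
      integral_map measurePreserving_ofTorus.measurable.aemeasurable hAE]
    refine integral_congr_ae (Filter.Eventually.of_forall fun y => ?_)
    simp only [latticeChar_ofTorus, neg_neg, smul_eq_mul, Function.comp_apply]
    exact mul_comm _ _
  have hlin : ∫⁻ g in fundDomain, ‖periodize f (toCoset g)‖ₑ ^ 2 ∂(haar c) =
      K * ∑' n : Fin 3 → ℤ, ‖UnitAddTorus.mFourierCoeff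
        ((fun g => periodize f (toCoset g)) ∘ ofTorus) (-n)‖ₑ ^ 2 := by
    have hneg := (Equiv.neg (Fin 3 → ℤ)).tsum_eq (fun n => ‖UnitAddTorus.mFourierCoeff
        ((fun g => periodize f (toCoset g)) ∘ ofTorus) n‖ₑ ^ 2)
    simp only [Equiv.neg_apply] at hneg
    rw [hneg, tsum_enorm_sq_mFourierCoeff hG,
      hrestr, lintegral_smul_measure, smul_eq_mul, ← measurePreserving_ofTorus.map_eq,
      lintegral_map']
    · rfl
    · rw [measurePreserving_ofTorus.map_eq]
      exact hF1.1.enorm.pow_const 2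
    · exact measurePreserving_ofTorus.measurable.aemeasurable
  have hKn : ‖((2 * Real.pi * c : ℝ) : ℂ)‖ₑ = K := by
    rw [← ofReal_norm, Complex.norm_real, Real.norm_of_nonneg hKpos.le]
  simp only [hcoef, enorm_mul, mul_pow, hKn]
  rw [ENNReal.tsum_mul_left, eLpNorm_periodize_sq hf, hlin, ← mul_assoc, sq]

end Parseval

/-! ### Polar coordinates of the nonzero integral vectors, and the Plancherel formula -/

section PolarCoordinates

/-- The nonzero integral vector with the polar coordinates `(ρ, θ)`. -/
def polarPoint (q : Σ ρ : radii, angles ρ) : {k : ℤ × ℤ // k ≠ 0} :=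
  ⟨(q.2.2.2.choose, q.2.2.2.choose_spec.choose), by
    generalize_proofs h1 h2
    have h := h2.choose_spec.1
    intro h0
    rw [Prod.mk_eq_zero] at h0
    generalize h2.choose = l at h h0
    generalize h1.choose = k at h h0
    obtain ⟨rfl, rfl⟩ := h0
    exact q.1.2.1.ne' (by simpa using h)⟩

theorem polarPoint_spec (q : Σ ρ : radii, angles ρ) :
    (q.1 : ℝ) = √(((polarPoint q).1.1 : ℝ) ^ 2 + ((polarPoint q).1.2 : ℝ) ^ 2) ∧
      ((polarPoint q).1.1 : ℝ) = q.1 * Real.cos q.2 ∧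
      ((polarPoint q).1.2 : ℝ) = q.1 * Real.sin q.2 :=
  q.2.2.2.choose_spec.choose_spec

/-- The length recovers ρ > 0; dividing by it gives cos θ and sin θ, which determine θ within one
period. -/
theorem polarPoint_injective : Function.Injective polarPoint := by
  rintro ⟨⟨ρ, hρ⟩, ⟨θ, hθ⟩⟩ ⟨⟨ρ', hρ'⟩, ⟨θ', hθ'⟩⟩ h
  obtain ⟨h1, h2, h3⟩ := polarPoint_spec ⟨⟨ρ, hρ⟩, ⟨θ, hθ⟩⟩
  obtain ⟨h1', h2', h3'⟩ := polarPoint_spec ⟨⟨ρ', hρ'⟩, ⟨θ', hθ'⟩⟩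
  rw [← h] at h1' h2' h3'
  simp only at h1 h2 h3 h1' h2' h3'
  obtain rfl : ρ = ρ' := h1.trans h1'.symm
  have hc : Real.cos θ = Real.cos θ' := mul_left_cancel₀ hρ.1.ne' (h2.symm.trans h2')
  have hs : Real.sin θ = Real.sin θ' := mul_left_cancel₀ hρ.1.ne' (h3.symm.trans h3')
  have hang := Real.Angle.cos_sin_inj hc hs
  have hθ1 := hθ.1
  have hθ1' := hθ'.1
  rw [← zero_add (2 * Real.pi)] at hθ1 hθ1'
  obtain rfl : θ = θ' := (AddCircle.coe_eq_coe_iff_of_mem_Ico hθ1 hθ1').1 hang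
  rfl

theorem polarPoint_surjective : Function.Surjective polarPoint := by
  rintro ⟨⟨k₁, k₂⟩, hk⟩
  set z : ℂ := ⟨k₁, k₂⟩ with hz
  have hz0 : z ≠ 0 := fun h => hk (by
    have h1 := congrArg Complex.re h
    have h2 := congrArg Complex.im h
    simp only [hz, Complex.zero_re, Complex.zero_im, Int.cast_eq_zero] at h1 h2
    rw [h1, h2]; rfl)
  have hnorm : ‖z‖ = √((k₁ : ℝ) ^ 2 + (k₂ : ℝ) ^ 2) := by
    rw [Complex.norm_def, Complex.normSq_apply]; simp only [hz, sq]
  -- The argument in (-π, π] is moved to [0, 2π).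
  set θ := toIcoMod Real.two_pi_pos 0 (Complex.arg z) with hθ
  have hmod : θ = Complex.arg z - toIcoDiv Real.two_pi_pos 0 (Complex.arg z) * (2 * Real.pi) := by
    rw [hθ, toIcoMod, zsmul_eq_mul]
  have hcos : (k₁ : ℝ) = ‖z‖ * Real.cos θ := by
    rw [hmod, Real.cos_sub_int_mul_two_pi, Complex.norm_mul_cos_arg]
  have hsin : (k₂ : ℝ) = ‖z‖ * Real.sin θ := by
    rw [hmod, Real.sin_sub_int_mul_two_pi, Complex.norm_mul_sin_arg]
  have hmem : θ ∈ Set.Ico 0 (2 * Real.pi) := by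
    have := toIcoMod_mem_Ico Real.two_pi_pos 0 (Complex.arg z)
    rwa [zero_add] at this
  refine ⟨⟨⟨‖z‖, norm_pos_iff.2 hz0, k₁, k₂, hnorm⟩, ⟨θ, hmem, k₁, k₂, hnorm, hcos, hsin⟩⟩, ?_⟩
  obtain ⟨-, h2, h3⟩ := polarPoint_spec
    ⟨⟨‖z‖, norm_pos_iff.2 hz0, k₁, k₂, hnorm⟩, ⟨θ, hmem, k₁, k₂, hnorm, hcos, hsin⟩⟩
  apply Subtype.ext
  apply Prod.ext
  · exact_mod_cast h2.trans hcos.symm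
  · exact_mod_cast h3.trans hsin.symm

/-- Polar coordinates on the set of the nonzero integral vectors. -/
def polarEquiv : (Σ ρ : radii, angles ρ) ≃ {k : ℤ × ℤ // k ≠ 0} :=
  Equiv.ofBijective polarPoint ⟨polarPoint_injective, polarPoint_surjective⟩

theorem tsum_int_prod_eq (a : ℤ × ℤ → ℝ≥0∞) :
    ∑' k, a k = a 0 + ∑' ρ : radii, ∑' θ : angles ρ, a (polarPoint ⟨ρ, θ⟩).1 := by
  rw [← ENNReal.tsum_sigma (fun (ρ : radii) (θ : angles ρ) => a (polarPoint ⟨ρ, θ⟩).1)]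
  have h := polarEquiv.tsum_eq fun k => a k.1
  change ∑' q, a (polarPoint q).1 = _ at h
  change _ = a 0 + ∑' q, a (polarPoint q).1
  rw [h, ← Summable.tsum_add_tsum_compl (f := a) (s := {(0 : ℤ × ℤ)}) ENNReal.summable ENNReal.summable,
    tsum_singleton]
  rfl

theorem tsum_fin_three_eq (b : ℤ → ℤ → ℤ → ℝ≥0∞) :
    ∑' n : Fin 3 → ℤ, b (n 0) (n 1) (n 2) = ∑' k : ℤ × ℤ, ∑' m : ℤ, b k.1 k.2 m := by
  rw [← ENNReal.tsum_prod (f := fun (k : ℤ × ℤ) m => b k.1 k.2 m)]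
  let e : (Fin 3 → ℤ) ≃ (ℤ × ℤ) × ℤ :=
    { toFun := fun n => ((n 0, n 1), n 2)
      invFun := fun p => ![p.1.1, p.1.2, p.2]
      left_inv := fun n => by ext i; fin_cases i <;> rfl
      right_inv := fun _ => rfl }
  exact e.tsum_eq fun p => b p.1.1 p.1.2 p.2

end PolarCoordinates

/-! ### The inner series as integrals against lattice characters, and the conclusion. -/

theorem wave_eq_fourier_mul {ρ θ : ℝ} {k₁ k₂ : ℤ} (h1 : (k₁ : ℝ) = ρ * Real.cos θ)
    (h2 : (k₂ : ℝ) = ρ * Real.sin θ) (x : ℂ) : wave (2 * Real.pi * ρ) x (θ : Angle) =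
      fourier k₁ (x.re : UnitAddCircle) * fourier k₂ (x.im : UnitAddCircle) := by
  rw [wave_coe, fourier_coe_apply, fourier_coe_apply, ← Complex.exp_add]
  congr 1
  have : phase (2 * Real.pi * ρ * x.re) (2 * Real.pi * ρ * x.im) 0 θ =
      2 * Real.pi * (k₁ * x.re + k₂ * x.im) := by
    rw [h1, h2, phase]; ring
  rw [this]
  push_cast
  ring

theorem enorm_tsum_seriesTerm {c : ℝ} {f : SE2 → ℂ} (hf : Integrable f (haar c)) {ρ θ : ℝ}
    {k₁ k₂ : ℤ} (h1 : (k₁ : ℝ) = ρ * Real.cos θ) (h2 : (k₂ : ℝ) = ρ * Real.sin θ) (m : ℤ) :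
    ‖∑'[SummationFilter.conditional ℤ] n : ℤ, seriesTerm c f ρ θ m n‖ₑ =
      ‖∫ g, f g * latticeChar k₁ k₂ m g ∂(haar c)‖ₑ := by
  have hfac : ∀ g : SE2, f g * (Complex.exp (-Complex.I * m * θ) * fourier m g.rot *
      wave (2 * Real.pi * ρ) g.trans (θ : Angle)) =
      Complex.exp (-Complex.I * m * θ) * (f g * latticeChar k₁ k₂ m g) := fun g => by
    rw [wave_eq_fourier_mul h1 h2, latticeChar]; ring
  have hphase : ‖Complex.exp (-Complex.I * m * θ)‖ₑ = 1 := by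
    rw [← ofReal_norm, show -Complex.I * m * θ = Complex.I * (-(m * θ) : ℝ) by push_cast; ring,
      norm_cexp_I_mul_ofReal, ENNReal.ofReal_one]
  rw [(hasSum_seriesTerm hf ρ θ m).tsum_eq]
  simp only [hfac]
  rw [integral_const_mul, enorm_mul, hphase, one_mul]

theorem fourierChar_eq (c : ℝ) (f : SE2 → ℂ) (k : ℤ) :
    fourierChar c f k = ∫ g, f g * latticeChar 0 0 (-k) g ∂(haar c) := by
  simp only [fourierChar, character, latticeChar, fourier_zero, one_mul, fourier_neg]

end SE2Plancherel

end

theorem mainTheorem5 (c : ℝ) (hc : 0 < c) (f : SE2Plancherel.SE2 → ℂ)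
    (hf : Integrable f (SE2Plancherel.haar c))
    (hf2 : MemLp (SE2Plancherel.periodize fun g => ‖f g‖) 2 (SE2Plancherel.cosetMeasure c)) :
    MemLp (SE2Plancherel.periodize f) 2 (SE2Plancherel.cosetMeasure c) ∧
    (∀ ρ ∈ SE2Plancherel.radii, ∀ θ ∈ SE2Plancherel.angles ρ, ∀ m : ℤ,
      Summable (SE2Plancherel.seriesTerm c f ρ θ m) (SummationFilter.conditional ℤ)) ∧
    ENNReal.ofReal (2 * Real.pi * c) *
        eLpNorm (SE2Plancherel.periodize f) 2 (SE2Plancherel.cosetMeasure c) ^ 2 =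
      (∑' k : ℤ, ‖SE2Plancherel.fourierChar c f k‖ₑ ^ 2) +
        ∑' ρ : SE2Plancherel.radii, ∑' θ : SE2Plancherel.angles ρ, ∑' m : ℤ,
          ‖∑'[SummationFilter.conditional ℤ] n : ℤ,
            SE2Plancherel.seriesTerm c f ρ θ m n‖ₑ ^ 2 := by
  have hmem := SE2Plancherel.memLp_periodize hf hf2
  refine ⟨hmem, fun ρ _ θ _ m => (SE2Plancherel.hasSum_seriesTerm hf ρ θ m).summable, ?_⟩
  rw [SE2Plancherel.parseval_periodize hc hf hmem,
    SE2Plancherel.tsum_fin_three_eq fun k₁ k₂ m =>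
      ‖∫ g, f g * SE2Plancherel.latticeChar k₁ k₂ m g ∂(SE2Plancherel.haar c)‖ₑ ^ 2,
    SE2Plancherel.tsum_int_prod_eq]
  congr 1
  -- The conjugate in f̂[k] turns k into -k, which the sum over ℤ does not see.
  · simp only [SE2Plancherel.fourierChar_eq]
    exact ((Equiv.neg ℤ).tsum_eq _).symm
  · refine tsum_congr fun ρ => tsum_congr fun θ => tsum_congr fun m => ?_
    obtain ⟨-, h1, h2⟩ := SE2Plancherel.polarPoint_spec ⟨ρ, θ⟩
    rw [SE2Plancherel.enorm_tsum_seriesTerm hf h1 h2]
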